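/- Let $-\infty\le a<b\le\infty$ and let $p,q,r,s$ be Lebesgue measurable, real-valued functions on $(a,b)$ with $p^{-1},q,r,s\in L^1_{\mathrm{loc}}((a,b);dx)$ and $r>0$, $p\neq 0$ a.e. on $(a,b)$. Let $\mathfrak D_\tau$ be the set of complex-valued $f\in AC_{\mathrm{loc}}((a,b))$ whose first quasi-derivative $f^{[1]}=p\,(f'+sf)$ also lies in $AC_{\mathrm{loc}}((a,b))$, and put $$\tau f=\frac1r\left(-\big(f^{[1]}\big)'+s f^{[1]}+q f\right),\qquad f\in\mathfrak D_\tau .$$ In the Hilbert space $L^2((a,b);r(x)dx)$ let $T_{\max}f=\tau f$ with domain $\{f\in L^2((a,b);r(x)dx)\mid f\in\mathfrak D_\tau,\ \tau f\in L^2((a,b);r(x)dx)\}$, let $T_0$ be the restriction of $T_{\max}$ to the functions in its domain that have compact support in $(a,b)$, and let $T_{\min}=\overline{T_0}$ be the closure of $T_0$. A function lies in $L^2((a,b);r(x)dx)$ near $a$ (resp. near $b$) if it lies in $L^2((a,c);r(x)dx)$ (resp. in $L^2((c,b);r(x)dx)$) for each $c\in(a,b)$. One says that $\tau$ is limit-circle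 (l.c.) at an endpoint if for each $z\in\mathbb C$ all solutions $u\in\mathfrak D_\tau$ of $(\tau-z)u=0$ lie in $L^2((a,b);r(x)dx)$ near that endpoint, and limit-point (l.p.) at an endpoint if for each $z\in\mathbb C$ some solution $u\in\mathfrak D_\tau$ of $(\tau-z)u=0$ does not lie in $L^2((a,b);r(x)dx)$ near that endpoint. Then the following hold. (0) $T_0$ is densely defined and closable, and $T_{\min}$ is symmetric, so that $T_{\min}$ and its deficiency indices $n_\pm(T_{\min})=\dim\big(\operatorname{ran}(T_{\min}\pm \mathrm i)^{\perp}\big)$ are well defined. (i) (Weyl's alternative) At each of the endpoints $a$ and $b$, $\tau$ is either l.c. or l.p., and not both. (ii) The deficiency indices of $T_{\min}$ are equal and given by $$n_+(T_{\min})=n_-(T_{\min})=\begin{cases}0,&\text{if }\tau\text{ is l.c. at neither endpoint},\\ 1,&\text{if }\tau\text{ is l.c. at exactly one endpoint},\\ 2,&\text{if }\tau\text{ is l.c. at both endpoints.}\end{cases}$$ (iii) If $\tau$ is l.p. at both endpoints, then $T_{\min}=T_{\max}$, and this operator is self-adjoint. -/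

import Mathlib

open MeasureTheory Set Filter Topology

noncomputable section

/-- Coefficients of a Sturm--Liouville differential expression
`τ f = (1/r) (-(f^[1])' + s f^[1] + q f)`, `f^[1] = p (f' + s f)`, on a nonempty open interval
`(a, b) ⊆ ℝ`, bounded or not: `p`, `q`, `r`, `s` are real-valued and Lebesgue measurable on
`(a, b)`, `1/p`, `q`, `r`, `s` are locally integrable there, and `r > 0`, `p ≠ 0` a.e. -/
structure SturmLiouville where
  a : EReal
  b : EReal
  p : ℝ → ℝ
  q : ℝ → ℝ
  r : ℝ → ℝ
  s : ℝ → ℝ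
  a_lt_b : a < b
  aemeasurable_p : AEMeasurable p (volume.restrict {x : ℝ | a < x ∧ x < b})
  locInt_inv_p : LocallyIntegrableOn (fun x => (p x)⁻¹) {x : ℝ | a < x ∧ x < b} volume
  locInt_q : LocallyIntegrableOn q {x : ℝ | a < x ∧ x < b} volume
  locInt_r : LocallyIntegrableOn r {x : ℝ | a < x ∧ x < b} volume
  locInt_s : LocallyIntegrableOn s {x : ℝ | a < x ∧ x < b} volume
  r_pos : ∀ᵐ x ∂(volume.restrict {x : ℝ | a < x ∧ x < b}), 0 < r x
  p_ne_zero : ∀ᵐ x ∂(volume.restrict {x : ℝ | a < x ∧ x < b}), p x ≠ 0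

namespace SturmLiouville

variable (τ : SturmLiouville)

/-- The open interval `(a, b)`. -/
def I : Set ℝ := {x : ℝ | τ.a < x ∧ x < τ.b}

/-- The measure `r(x) dx` on `(a, b)`. -/
def μ : Measure ℝ := (volume.restrict τ.I).withDensity (fun x => ENNReal.ofReal (τ.r x))

/-- The Hilbert space `L²((a, b); r(x) dx)`. -/
abbrev H : Type := Lp ℂ 2 τ.μ

/-- `f ∈ AC_loc((a, b))`. -/
def ACLoc (f : ℝ → ℂ) : Prop :=
  ∀ α ∈ τ.I, ∀ β ∈ τ.I, AbsolutelyContinuousOnInterval f α β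

/-- `f ∈ 𝔇_τ` with first quasi-derivative `f₁ = f^[1] = p (f' + s f)`: both `f` and `f₁` are
locally absolutely continuous on `(a, b)`. On `(a, b)` the function `f₁` is determined by `f`, as
the locally absolutely continuous representative of `p (f' + s f)`. -/
structure IsQuasiDeriv (f f₁ : ℝ → ℂ) : Prop where
  ac : τ.ACLoc f
  ac₁ : τ.ACLoc f₁
  eq : f₁ =ᵐ[volume.restrict τ.I] fun x => (τ.p x : ℂ) * (deriv f x + (τ.s x : ℂ) * f x)

/-- The function `τ f`, for `f ∈ 𝔇_τ` with first quasi-derivative `f₁`. -/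
def expr (f f₁ : ℝ → ℂ) (x : ℝ) : ℂ :=
  (1 / (τ.r x : ℂ)) * (-deriv f₁ x + (τ.s x : ℂ) * f₁ x + (τ.q x : ℂ) * f x)

/-- `u ∈ 𝔇_τ` is a solution of `(τ - z) u = 0` on `(a, b)`. -/
def IsSolution (z : ℂ) (u : ℝ → ℂ) : Prop :=
  ∃ u₁ : ℝ → ℂ, τ.IsQuasiDeriv u u₁ ∧
    ∀ᵐ x ∂(volume.restrict τ.I), τ.expr u u₁ x - z * u x = 0

/-- `f` lies in `L²((a, b); r(x) dx)` near `a`. -/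
def L2NearA (f : ℝ → ℂ) : Prop :=
  ∀ c ∈ τ.I, MemLp f 2 (τ.μ.restrict (Iio c))

/-- `f` lies in `L²((a, b); r(x) dx)` near `b`. -/
def L2NearB (f : ℝ → ℂ) : Prop :=
  ∀ c ∈ τ.I, MemLp f 2 (τ.μ.restrict (Ioi c))

/-- `τ` is in the limit-circle case at `a`. -/
def LimitCircleA : Prop := ∀ z : ℂ, ∀ u : ℝ → ℂ, τ.IsSolution z u → τ.L2NearA u

/-- `τ` is in the limit-point case at `a`. -/
def LimitPointA : Prop := ∀ z : ℂ, ∃ u : ℝ → ℂ, τ.IsSolution z u ∧ ¬ τ.L2NearA u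

/-- `τ` is in the limit-circle case at `b`. -/
def LimitCircleB : Prop := ∀ z : ℂ, ∀ u : ℝ → ℂ, τ.IsSolution z u → τ.L2NearB u

/-- `τ` is in the limit-point case at `b`. -/
def LimitPointB : Prop := ∀ z : ℂ, ∃ u : ℝ → ℂ, τ.IsSolution z u ∧ ¬ τ.L2NearB u

/-! ### Facts needed to see that the maximal operator is a well-defined linear operator -/

lemma isOpen_I : IsOpen τ.I :=
  (isOpen_lt continuous_const continuous_coe_real_ereal).inter
    (isOpen_lt continuous_coe_real_ereal continuous_const)

lemma measurableSet_I : MeasurableSet τ.I := τ.isOpen_I.measurableSet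

lemma ordConnected_I : OrdConnected τ.I :=
  ⟨fun _ hx _ hy _ hz => ⟨hx.1.trans_le (EReal.coe_le_coe_iff.2 hz.1),
    (EReal.coe_le_coe_iff.2 hz.2).trans_lt hy.2⟩⟩

lemma ae_μ_iff {P : ℝ → Prop} : (∀ᵐ x ∂τ.μ, P x) ↔ ∀ᵐ x ∂(volume.restrict τ.I), P x := by
  have hr : AEMeasurable (fun x => ENNReal.ofReal (τ.r x)) (volume.restrict τ.I) :=
    (τ.locInt_r.aestronglyMeasurable).aemeasurable.ennreal_ofReal
  rw [μ, ae_withDensity_iff' hr]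
  constructor
  · intro h
    filter_upwards [h, (show ∀ᵐ x ∂(volume.restrict τ.I), 0 < τ.r x from τ.r_pos)] with x hx hx'
    exact hx (by simpa using hx')
  · intro h
    filter_upwards [h] with x hx _ using hx

variable {τ}

lemma ACLoc.continuousOn {f : ℝ → ℂ} (hf : τ.ACLoc f) : ContinuousOn f τ.I := by
  intro x hx
  obtain ⟨ε, hε, hb⟩ := Metric.isOpen_iff.1 τ.isOpen_I x hx
  have hl : x - ε / 2 ∈ τ.I := hb (by simp [abs_of_pos hε]; linarith)
  have hr : x + ε / 2 ∈ τ.I := hb (by simp [abs_of_pos hε]; linarith)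
  have h := (hf _ hl _ hr).continuousOn
  rw [uIcc_of_le (by linarith)] at h
  exact (h.continuousAt (Icc_mem_nhds (by linarith) (by linarith))).continuousWithinAt

lemma ACLoc.ae_differentiableAt {f : ℝ → ℂ} (hf : τ.ACLoc f) :
    ∀ᵐ x ∂(volume.restrict τ.I), DifferentiableAt ℝ f x := by
  have hbv : LocallyBoundedVariationOn f τ.I := fun x y hx hy => by
    refine ((hf x hx y hy).boundedVariationOn).mono ?_
    exact inter_subset_right.trans Icc_subset_uIcc
  rw [ae_restrict_iff' τ.measurableSet_I]
  filter_upwards [hbv.ae_differentiableWithinAt_of_mem] with x hx hxI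
  exact (hx hxI).differentiableAt (τ.isOpen_I.mem_nhds hxI)

lemma eqOn_zero_of_ae {f : ℝ → ℂ} (hf : τ.ACLoc f)
    (h : ∀ᵐ x ∂(volume.restrict τ.I), f x = 0) : EqOn f 0 τ.I :=
  Measure.eqOn_open_of_ae_eq (μ := volume) h τ.isOpen_I hf.continuousOn continuousOn_const

lemma IsQuasiDeriv.add {f f₁ g g₁ : ℝ → ℂ} (hf : τ.IsQuasiDeriv f f₁) (hg : τ.IsQuasiDeriv g g₁) :
    τ.IsQuasiDeriv (f + g) (f₁ + g₁) where
  ac := fun α hα β hβ => (hf.ac α hα β hβ).add (hg.ac α hα β hβ)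
  ac₁ := fun α hα β hβ => (hf.ac₁ α hα β hβ).add (hg.ac₁ α hα β hβ)
  eq := by
    filter_upwards [hf.eq, hg.eq, hf.ac.ae_differentiableAt, hg.ac.ae_differentiableAt]
      with x h1 h2 h3 h4
    rw [deriv_add h3 h4]
    simp only [Pi.add_apply, h1, h2]
    ring

lemma IsQuasiDeriv.smul {f f₁ : ℝ → ℂ} (c : ℂ) (hf : τ.IsQuasiDeriv f f₁) :
    τ.IsQuasiDeriv (c • f) (c • f₁) where
  ac := fun α hα β hβ => (hf.ac α hα β hβ).const_smul c
  ac₁ := fun α hα β hβ => (hf.ac₁ α hα β hβ).const_smul c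
  eq := by
    filter_upwards [hf.eq] with x h1
    rw [deriv_const_smul_field]
    simp only [Pi.smul_apply, h1, smul_eq_mul]
    ring

lemma IsQuasiDeriv.zero : τ.IsQuasiDeriv 0 0 where
  ac := fun α _ β _ =>
    (LipschitzWith.const (0 : ℂ)).lipschitzOnWith.absolutelyContinuousOnInterval
  ac₁ := fun α _ β _ =>
    (LipschitzWith.const (0 : ℂ)).lipschitzOnWith.absolutelyContinuousOnInterval
  eq := Eventually.of_forall fun x => by simp

variable (τ)

/-- The graph of the maximal operator: all pairs `(F, G)` in `L²((a, b); r(x) dx)` such that `F`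
has a representative `f ∈ 𝔇_τ` with `τ f = G`. -/
def maxGraph : Submodule ℂ (τ.H × τ.H) where
  carrier := {F | ∃ f f₁ : ℝ → ℂ, τ.IsQuasiDeriv f f₁ ∧
    (F.1 : ℝ → ℂ) =ᵐ[τ.μ] f ∧ (F.2 : ℝ → ℂ) =ᵐ[τ.μ] τ.expr f f₁}
  zero_mem' := by
    refine ⟨0, 0, IsQuasiDeriv.zero, Lp.coeFn_zero .., ?_⟩
    refine (Lp.coeFn_zero ..).trans (Eventually.of_forall fun x => ?_)
    simp [expr]
  add_mem' := by
    rintro F G ⟨f, f₁, hf, hf1, hf2⟩ ⟨g, g₁, hg, hg1, hg2⟩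
    refine ⟨f + g, f₁ + g₁, hf.add hg, (Lp.coeFn_add ..).trans (hf1.add hg1), ?_⟩
    refine (Lp.coeFn_add ..).trans ?_
    filter_upwards [hf2, hg2, τ.ae_μ_iff.2 hf.ac₁.ae_differentiableAt,
      τ.ae_μ_iff.2 hg.ac₁.ae_differentiableAt] with x h1 h2 h3 h4
    simp only [Pi.add_apply, h1, h2, expr]
    rw [deriv_add h3 h4]
    ring
  smul_mem' := by
    rintro c F ⟨f, f₁, hf, hf1, hf2⟩
    refine ⟨c • f, c • f₁, hf.smul c, (Lp.coeFn_smul ..).trans (hf1.const_smul c), ?_⟩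
    refine (Lp.coeFn_smul ..).trans ?_
    filter_upwards [hf2] with x h1
    simp only [Pi.smul_apply, h1, expr]
    rw [deriv_const_smul_field]
    simp only [smul_eq_mul]
    ring

/-- `maxGraph` is the graph of an operator: it is single-valued. -/
lemma maxGraph_fst_eq_zero (F : τ.H × τ.H) (hF : F ∈ τ.maxGraph) (h0 : F.1 = 0) : F.2 = 0 := by
  obtain ⟨f, f₁, hf, h1, h2⟩ := hF
  have hf0 : EqOn f 0 τ.I := by
    refine eqOn_zero_of_ae hf.ac (τ.ae_μ_iff.1 ?_)
    rw [h0] at h1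
    filter_upwards [h1, Lp.coeFn_zero ℂ 2 τ.μ] with x hx hx'
    rw [← hx, hx', Pi.zero_apply]
  have hd : ∀ {g : ℝ → ℂ}, EqOn g 0 τ.I → ∀ x ∈ τ.I, deriv g x = 0 := fun hg x hx => by
    rw [(hg.eventuallyEq_of_mem (τ.isOpen_I.mem_nhds hx)).deriv_eq]
    simp
  have hf10 : EqOn f₁ 0 τ.I := by
    refine eqOn_zero_of_ae hf.ac₁ ?_
    filter_upwards [hf.eq, ae_restrict_mem τ.measurableSet_I] with x hx hxI
    rw [hx, hd hf0 x hxI, hf0 hxI]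
    simp
  refine Lp.ext (h2.trans (EventuallyEq.trans ?_ (Lp.coeFn_zero ℂ 2 τ.μ).symm))
  refine τ.ae_μ_iff.2 ?_
  filter_upwards [ae_restrict_mem τ.measurableSet_I] with x hxI
  simp [expr, hd hf10 x hxI, hf0 hxI, hf10 hxI]

/-! ### The operators -/

/-- The maximal operator `T_max`. -/
def Tmax : τ.H →ₗ.[ℂ] τ.H := τ.maxGraph.toLinearPMap

/-- The graph of `T_max` is as prescribed. -/
lemma Tmax_graph : τ.Tmax.graph = τ.maxGraph :=
  Submodule.toLinearPMap_graph_eq _ (fun F hF => τ.maxGraph_fst_eq_zero F hF)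

/-- The elements of `L²((a, b); r(x) dx)` with compact support in `(a, b)`. -/
def compactlySupported : Submodule ℂ τ.H where
  carrier := {F | ∃ K : Set ℝ, IsCompact K ∧ K ⊆ τ.I ∧ ∀ᵐ x ∂τ.μ, x ∉ K → F x = 0}
  zero_mem' := ⟨∅, isCompact_empty, empty_subset _, by
    filter_upwards [Lp.coeFn_zero ℂ 2 τ.μ] with x hx _
    rw [hx, Pi.zero_apply]⟩
  add_mem' := by
    rintro F G ⟨K, hK, hKI, hF⟩ ⟨L, hL, hLI, hG⟩
    refine ⟨K ∪ L, hK.union hL, union_subset hKI hLI, ?_⟩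
    filter_upwards [hF, hG, Lp.coeFn_add F G] with x h1 h2 h3 hx
    rw [h3, Pi.add_apply, h1 (fun h => hx (Or.inl h)), h2 (fun h => hx (Or.inr h)), add_zero]
  smul_mem' := by
    rintro c F ⟨K, hK, hKI, hF⟩
    refine ⟨K, hK, hKI, ?_⟩
    filter_upwards [hF, Lp.coeFn_smul c F] with x h1 h2 hx
    rw [h2, Pi.smul_apply, h1 hx, smul_zero]

/-- The operator `T₀`: the restriction of `T_max` to functions with compact support. -/
def T0 : τ.H →ₗ.[ℂ] τ.H := τ.Tmax.domRestrict τ.compactlySupported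

/-- The minimal operator `T_min`: the closure of `T₀`. -/
def Tmin : τ.H →ₗ.[ℂ] τ.H := τ.T0.closure

end SturmLiouville

/-- `dim (ran (T - z))^⊥`. The deficiency indices of a densely defined symmetric operator `T` are
its values at `z = i` and `z = -i`. -/
def defectNumber {E : Type*} [NormedAddCommGroup E] [InnerProductSpace ℂ E]
    (T : E →ₗ.[ℂ] E) (z : ℂ) : Cardinal :=
  Module.rank ℂ ↥(LinearMap.range (T.toFun - z • T.domain.subtype))ᗮ

end

/-!
The equation `(τ - z) u = h` is a linear first-order system for `(u, u^[1])` with locally integrable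
coefficients; Picard iteration of the Volterra equation gives existence for initial values at an
interior point `c`, and constancy of the Wronskian gives uniqueness. Call a solution square
integrable at an endpoint if it lies in `L²` near it.

Limit-circle case. Variation of constants expresses a solution for `z'` through a fundamental
system for `z`, with error term `(z' - z) u`; by Grönwall's inequality its coefficients stay bounded
as soon as the fundamental system is square integrable at the endpoint. Hence whether all solutions
are square integrable at the endpoint does not depend on `z`: this is Weyl's alternative.

Limit-point case. For `z ∉ ℝ`, Lagrange's identity makes `Im z · Im (v · conj v^[1])` increase along
the interval, with increments `(Im z)² ∫ r |v|²`. By compactness of the unit sphere of initial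
values some nonzero solution keeps this form, taken with the sign that makes it increase towards the
endpoint, nonpositive up to the endpoint, which bounds `∫ r |v|²`. So the square integrable
solutions form a line whenever `τ` is not limit-circle there, and, the two endpoints having opposite
signs, no nonzero solution is square integrable at two such endpoints.

Operators. The range of `T₀` contains every compactly supported function orthogonal to the solutions
of `τ u = 0` on its support, which gives `T₀* = T_max`. Therefore `T_min* = T_max`, the defect space
of `T_min` at `z` consists of the solutions for `conj z` in `L²((a, b); r(x) dx)`, and a closed
symmetric operator with trivial defect spaces at `±i` is self-adjoint.
-/

/-! ### Absolutely continuous functions -/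

lemma absolutelyContinuousOnInterval_of_dist_le_mul {X Y : Type*} [PseudoMetricSpace X]
    [PseudoMetricSpace Y] {f : ℝ → X} {g : ℝ → Y} {a b K : ℝ}
    (hg : AbsolutelyContinuousOnInterval g a b)
    (h : ∀ x ∈ uIcc a b, ∀ y ∈ uIcc a b, dist (f x) (f y) ≤ K * dist (g x) (g y)) :
    AbsolutelyContinuousOnInterval f a b := by
  have hK : 0 < |K| + 1 := by positivity
  rw [absolutelyContinuousOnInterval_iff] at hg ⊢
  intro ε hε
  obtain ⟨δ, hδ, H⟩ := hg (ε / (|K| + 1)) (by positivity)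
  refine ⟨δ, hδ, fun E hE hE' => ?_⟩
  calc ∑ i ∈ Finset.range E.1, dist (f (E.2 i).1) (f (E.2 i).2)
      ≤ ∑ i ∈ Finset.range E.1, (|K| + 1) * dist (g (E.2 i).1) (g (E.2 i).2) :=
        Finset.sum_le_sum fun i hi => (h _ (hE.1 i hi).1 _ (hE.1 i hi).2).trans
          (mul_le_mul_of_nonneg_right (by linarith [le_abs_self K]) dist_nonneg)
    _ = (|K| + 1) * ∑ i ∈ Finset.range E.1, dist (g (E.2 i).1) (g (E.2 i).2) := by
        rw [Finset.mul_sum]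
    _ < (|K| + 1) * (ε / (|K| + 1)) := mul_lt_mul_of_pos_left (H E hE hE') hK
    _ = ε := by field_simp

lemma absolutelyContinuousOnInterval_lipschitzOnWith_comp {X Y : Type*} [PseudoMetricSpace X]
    [PseudoMetricSpace Y] {φ : X → Y} {f : ℝ → X} {s : Set X} {K : NNReal} {a b : ℝ}
    (hφ : LipschitzOnWith K φ s) (hf : AbsolutelyContinuousOnInterval f a b)
    (hs : MapsTo f (uIcc a b) s) : AbsolutelyContinuousOnInterval (φ ∘ f) a b :=
  absolutelyContinuousOnInterval_of_dist_le_mul hf fun _ hx _ hy =>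
    hφ.dist_le_mul _ (hs hx) _ (hs hy)

lemma absolutelyContinuousOnInterval_intervalIntegral {E : Type*} [NormedAddCommGroup E]
    [NormedSpace ℝ E] {g : ℝ → E} {a b c : ℝ} (h : IntervalIntegrable g volume a b)
    (hc : c ∈ uIcc a b) : AbsolutelyContinuousOnInterval (fun x => ∫ t in c..x, g t) a b := by
  have hi : ∀ x ∈ uIcc a b, ∀ y ∈ uIcc a b, IntervalIntegrable g volume x y :=
    fun x hx y hy => h.mono_set (uIcc_subset_uIcc hx hy)
  refine absolutelyContinuousOnInterval_of_dist_le_mul (K := 1)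
    (h.norm.absolutelyContinuousOnInterval_intervalIntegral hc) fun x hx y hy => ?_
  rw [dist_comm, dist_comm (∫ t in c..x, ‖g t‖), dist_eq_norm, dist_eq_norm,
    intervalIntegral.integral_interval_sub_left (hi c hc y hy) (hi c hc x hx),
    intervalIntegral.integral_interval_sub_left (hi c hc y hy).norm (hi c hc x hx).norm, one_mul]
  exact intervalIntegral.norm_integral_le_abs_integral_norm

section FiniteDimensional

variable {E : Type*} [NormedAddCommGroup E] [NormedSpace ℝ E] [FiniteDimensional ℝ E]
  {f : ℝ → E} {a b : ℝ}

lemma ae_deriv_clm_comp_eq (hf : AbsolutelyContinuousOnInterval f a b) (φ : E →L[ℝ] ℝ) :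
    ∀ᵐ x, x ∈ uIoc a b → deriv (φ ∘ f) x = φ (deriv f x) := by
  filter_upwards [hf.boundedVariationOn.ae_differentiableAt_of_mem_uIcc] with x hx hxm
  exact (φ.hasFDerivAt.comp_hasDerivAt x (hx (uIoc_subset_uIcc hxm)).hasDerivAt).deriv

lemma intervalIntegrable_deriv_of_absolutelyContinuous
    (hf : AbsolutelyContinuousOnInterval f a b) : IntervalIntegrable (deriv f) volume a b := by
  let B := Module.finBasis ℝ E
  have hcoord : ∀ i, IntervalIntegrable (fun x => B.coord i (deriv f x) • B i) volume a b := by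
    intro i
    let φ := (B.coord i).toContinuousLinearMap
    have hφf : AbsolutelyContinuousOnInterval (φ ∘ f) a b :=
      absolutelyContinuousOnInterval_lipschitzOnWith_comp φ.lipschitz.lipschitzOnWith hf
        (mapsTo_univ _ _)
    have hcongr : deriv (φ ∘ f) =ᵐ[volume.restrict (uIoc a b)] fun x => B.coord i (deriv f x) := by
      rw [EventuallyEq, ae_restrict_iff' measurableSet_uIoc]
      exact ae_deriv_clm_comp_eq hf φ
    have hint := hφf.intervalIntegrable_deriv.congr_ae hcongr
    exact ⟨hint.1.smul_const (B i), hint.2.smul_const (B i)⟩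
  convert! IntervalIntegrable.sum Finset.univ fun i _ => hcoord i using 1
  ext x
  simp [B.sum_repr]

lemma integral_deriv_eq_sub_of_absolutelyContinuous
    (hf : AbsolutelyContinuousOnInterval f a b) : ∫ x in a..b, deriv f x = f b - f a := by
  refine (SeparatingDual.eq_iff_forall_dual_eq (R := ℝ)).2 fun φ => ?_
  have hφf : AbsolutelyContinuousOnInterval (φ ∘ f) a b :=
    absolutelyContinuousOnInterval_lipschitzOnWith_comp φ.lipschitz.lipschitzOnWith hf
      (mapsTo_univ _ _)
  rw [← φ.intervalIntegral_comp_comm (intervalIntegrable_deriv_of_absolutelyContinuous hf),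
    ← intervalIntegral.integral_congr_ae (ae_deriv_clm_comp_eq hf φ),
    hφf.integral_deriv_eq_sub, map_sub, Function.comp_apply, Function.comp_apply]

end FiniteDimensional

/-! ### Locally integrable functions on an open interval -/

section OpenInterval

variable {I : Set ℝ} {c x : ℝ}

lemma exists_Icc_mem_nhds_of_ordConnected (hI : OrdConnected I) (hIo : IsOpen I) (hc : c ∈ I)
    (hx : x ∈ I) : ∃ α ∈ I, ∃ β ∈ I, Icc α β ⊆ I ∧ c ∈ Icc α β ∧ Icc α β ∈ 𝓝 x := by
  obtain ⟨l, u, hxlu, hlu⟩ := mem_nhds_iff_exists_Ioo_subset.1 (hIo.mem_nhds hx)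
  obtain ⟨l', hl'⟩ := exists_between hxlu.1
  obtain ⟨u', hu'⟩ := exists_between hxlu.2
  have hlI : l' ∈ I := hlu ⟨hl'.1, hl'.2.trans hxlu.2⟩
  have huI : u' ∈ I := hlu ⟨hxlu.1.trans hu'.1, hu'.2⟩
  have hα : min c l' ∈ I := by rcases min_choice c l' with h | h <;> rwa [h]
  have hβ : max c u' ∈ I := by rcases max_choice c u' with h | h <;> rwa [h]
  exact ⟨min c l', hα, max c u', hβ, hI.out hα hβ, ⟨min_le_left _ _, le_max_left _ _⟩,
    Icc_mem_nhds ((min_le_right _ _).trans_lt hl'.2) (hu'.1.trans_le (le_max_right _ _))⟩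

lemma continuousOn_of_forall_Icc {X : Type*} [TopologicalSpace X] {f : ℝ → X}
    (hI : OrdConnected I) (hIo : IsOpen I) (hc : c ∈ I)
    (h : ∀ α ∈ I, ∀ β ∈ I, c ∈ Icc α β → ContinuousOn f (Icc α β)) : ContinuousOn f I := by
  intro x hx
  obtain ⟨α, hα, β, hβ, -, hcαβ, hnhds⟩ := exists_Icc_mem_nhds_of_ordConnected hI hIo hc hx
  exact ((h α hα β hβ hcαβ).continuousAt hnhds).continuousWithinAt

variable {E : Type*} [NormedAddCommGroup E] {g : ℝ → E}

lemma intervalIntegrable_of_locallyIntegrableOn (hg : LocallyIntegrableOn g I volume)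
    (hI : OrdConnected I) (hc : c ∈ I) (hx : x ∈ I) : IntervalIntegrable g volume c x :=
  (hg.integrableOn_compact_subset (hI.uIcc_subset hc hx) isCompact_uIcc).intervalIntegrable

lemma continuousOn_intervalIntegral_of_locallyIntegrableOn [NormedSpace ℝ E]
    (hg : LocallyIntegrableOn g I volume) (hI : OrdConnected I) (hIo : IsOpen I) (hc : c ∈ I) :
    ContinuousOn (fun x => ∫ t in c..x, g t) I := by
  refine continuousOn_of_forall_Icc hI hIo hc fun α hα β hβ hcαβ => ?_
  have hαβ := uIcc_of_le (hcαβ.1.trans hcαβ.2)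
  rw [← hαβ] at hcαβ ⊢
  exact intervalIntegral.continuousOn_primitive_interval'
    (intervalIntegrable_of_locallyIntegrableOn hg hI hα hβ) hcαβ

lemma ae_hasDerivAt_intervalIntegral_of_locallyIntegrableOn [NormedSpace ℝ E] [CompleteSpace E]
    (hg : LocallyIntegrableOn g I volume) (hI : OrdConnected I) (hIo : IsOpen I) (hc : c ∈ I) :
    ∀ᵐ x ∂volume.restrict I, HasDerivAt (fun x => ∫ t in c..x, g t) (g x) x := by
  rw [ae_iff, Measure.restrict_apply₀' hIo.measurableSet.nullMeasurableSet]
  refine measure_null_of_locally_null _ fun x hx => ?_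
  obtain ⟨α, hα, β, hβ, -, hcαβ, hnhds⟩ := exists_Icc_mem_nhds_of_ordConnected hI hIo hc hx.2
  have h := (intervalIntegrable_of_locallyIntegrableOn hg hI hα hβ).ae_hasDerivAt_integral
  rw [uIcc_of_le (hcαβ.1.trans hcαβ.2), ae_iff] at h
  refine ⟨_ ∩ Icc α β, inter_mem_nhdsWithin _ hnhds, measure_mono_null ?_ h⟩
  exact fun y hy hy' => hy.1.1 (hy' hy.2 c hcαβ)

end OpenInterval

/-! ### Linear Volterra equations with locally integrable coefficients -/

section Volterra

lemma intervalIntegral_mul_exp_intervalIntegral {k : ℝ → ℝ} {c x : ℝ}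
    (hk : IntervalIntegrable k volume c x) :
    ∫ t in c..x, k t * Real.exp (2 * ∫ u in c..t, k u) =
      (Real.exp (2 * ∫ u in c..x, k u) - 1) / 2 := by
  have hac : AbsolutelyContinuousOnInterval (fun t => ∫ u in c..t, k u) c x :=
    hk.absolutelyContinuousOnInterval_intervalIntegral left_mem_uIcc
  obtain ⟨M, hM⟩ := hac.exists_bound
  have hsmooth : ContDiff ℝ 1 fun y : ℝ => Real.exp (2 * y) / 2 := by fun_prop
  obtain ⟨K, hK⟩ := hsmooth.contDiffOn.exists_lipschitzOnWith one_ne_zero (convex_Icc (-M) M)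
    isCompact_Icc
  have hexp := absolutelyContinuousOnInterval_lipschitzOnWith_comp hK hac
    fun t ht => abs_le.1 (hM t ht)
  have hderiv : ∀ᵐ t, t ∈ uIoc c x →
      deriv ((fun y => Real.exp (2 * y) / 2) ∘ fun t => ∫ u in c..t, k u) t =
        k t * Real.exp (2 * ∫ u in c..t, k u) := by
    filter_upwards [hk.ae_hasDerivAt_integral] with t ht htm
    have h := ((ht (uIoc_subset_uIcc htm) c left_mem_uIcc).const_mul 2).exp.div_const 2
    rw [Function.comp_def, h.deriv]
    ring
  rw [← intervalIntegral.integral_congr_ae hderiv, hexp.integral_deriv_eq_sub]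
  simp [sub_div]

variable {k : ℝ → ℝ} {c x : ℝ}

lemma abs_intervalIntegral_mul_exp_abs_le (hk₀ : ∀ t, 0 ≤ k t)
    (hk : IntervalIntegrable k volume c x) :
    |∫ t in c..x, k t * Real.exp (2 * |∫ u in c..t, k u|)| ≤
      Real.exp (2 * |∫ u in c..x, k u|) / 2 := by
  suffices h : |∫ t in c..x, k t * Real.exp (2 * |∫ u in c..t, k u|)| =
      (Real.exp (2 * |∫ u in c..x, k u|) - 1) / 2 by linarith
  have hexp : 0 ≤ (Real.exp (2 * |∫ u in c..x, k u|) - 1) / 2 := by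
    have := Real.one_le_exp (mul_nonneg zero_le_two (abs_nonneg (∫ u in c..x, k u)))
    linarith
  rw [← abs_of_nonneg hexp]
  rcases le_total c x with hcx | hxc
  · have habs : ∀ t ∈ uIcc c x, |∫ u in c..t, k u| = ∫ u in c..t, k u := fun t ht =>
      abs_of_nonneg (intervalIntegral.integral_nonneg (uIcc_of_le hcx ▸ ht).1 fun u _ => hk₀ u)
    rw [habs x right_mem_uIcc, ← intervalIntegral_mul_exp_intervalIntegral hk]
    exact congrArg _ (intervalIntegral.integral_congr fun t ht => by simp only [habs t ht])
  · have habs : ∀ t ∈ uIcc c x, |∫ u in c..t, k u| = ∫ u in c..t, (-k) u := fun t ht => by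
      simp only [Pi.neg_apply]
      rw [intervalIntegral.integral_neg, ← intervalIntegral.integral_symm,
        intervalIntegral.integral_symm, abs_neg, abs_of_nonneg
        (intervalIntegral.integral_nonneg (uIcc_of_ge hxc ▸ ht).2 fun u _ => hk₀ u)]
    rw [habs x right_mem_uIcc, ← intervalIntegral_mul_exp_intervalIntegral hk.neg, ← abs_neg,
      ← intervalIntegral.integral_neg]
    exact congrArg _ (intervalIntegral.integral_congr fun t ht => by
      simp only [habs t ht, Pi.neg_apply, neg_mul])

variable {E : Type*} [NormedAddCommGroup E] [NormedSpace ℝ E]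

/-- Bielecki's weight: in the norm weighted by `exp (-2 |∫ k|)`, integrating against `k` halves. -/
lemma norm_intervalIntegral_le_of_norm_le_mul_exp {g : ℝ → E} {L : ℝ} (hk₀ : ∀ t, 0 ≤ k t)
    (hk : IntervalIntegrable k volume c x) (hL : 0 ≤ L)
    (hg : ∀ t ∈ uIcc c x, ‖g t‖ ≤ k t * (L * Real.exp (2 * |∫ u in c..t, k u|))) :
    ‖∫ t in c..x, g t‖ ≤ L / 2 * Real.exp (2 * |∫ u in c..x, k u|) := by
  have hcont : ContinuousOn (fun t => L * Real.exp (2 * |∫ u in c..t, k u|)) (uIcc c x) := by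
    have := intervalIntegral.continuousOn_primitive_interval' hk left_mem_uIcc
    fun_prop
  calc ‖∫ t in c..x, g t‖
      ≤ |∫ t in c..x, k t * (L * Real.exp (2 * |∫ u in c..t, k u|))| := by
        refine intervalIntegral.norm_integral_le_abs_of_norm_le ?_ (hk.mul_continuousOn hcont)
        filter_upwards [ae_restrict_mem measurableSet_uIoc] with t ht
          using hg t (uIoc_subset_uIcc ht)
    _ = L * |∫ t in c..x, k t * Real.exp (2 * |∫ u in c..t, k u|)| := by
        simp only [mul_left_comm _ L, intervalIntegral.integral_const_mul, abs_mul,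
          abs_of_nonneg hL]
    _ ≤ L / 2 * Real.exp (2 * |∫ u in c..x, k u|) := by
        rw [div_mul_comm, mul_comm]
        exact mul_le_mul_of_nonneg_right (abs_intervalIntegral_mul_exp_abs_le hk₀ hk) hL

lemma le_mul_exp_of_le_add_abs_intervalIntegral {N : ℝ → ℝ} {N₀ : ℝ} (hk₀ : ∀ t, 0 ≤ k t)
    (hk : IntervalIntegrable k volume c x) (hN : ContinuousOn N (uIcc c x)) (hN₀ : ∀ t, 0 ≤ N t)
    (h : ∀ t ∈ uIcc c x, N t ≤ N₀ + |∫ u in c..t, k u * N u|) :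
    N x ≤ 2 * N₀ * Real.exp (2 * |∫ u in c..x, k u|) := by
  set w : ℝ → ℝ := fun t => Real.exp (2 * |∫ u in c..t, k u|)
  have hw_pos : ∀ t, 0 < w t := fun t => Real.exp_pos _
  have hcont : ContinuousOn (fun t => N t / w t) (uIcc c x) := by
    have := intervalIntegral.continuousOn_primitive_interval' hk left_mem_uIcc
    exact hN.div (by fun_prop) fun t _ => (hw_pos t).ne'
  obtain ⟨t₀, ht₀, hmax⟩ := isCompact_uIcc.exists_isMaxOn nonempty_uIcc hcont
  set L := N t₀ / w t₀
  have hle : ∀ t ∈ uIcc c x, N t ≤ L * w t := fun t ht => (div_le_iff₀ (hw_pos t)).1 (hmax ht)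
  have hsub : uIcc c t₀ ⊆ uIcc c x := uIcc_subset_uIcc left_mem_uIcc ht₀
  have hint : |∫ u in c..t₀, k u * N u| ≤ L / 2 * w t₀ := by
    rw [← Real.norm_eq_abs]
    refine norm_intervalIntegral_le_of_norm_le_mul_exp hk₀ (hk.mono_set hsub)
      (div_nonneg (hN₀ t₀) (hw_pos t₀).le) fun t ht => ?_
    rw [Real.norm_of_nonneg (mul_nonneg (hk₀ t) (hN₀ t))]
    exact mul_le_mul_of_nonneg_left (hle t (hsub ht)) (hk₀ t)
  have hN₀_nonneg : 0 ≤ N₀ := by simpa using (hN₀ c).trans (h c left_mem_uIcc)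
  have hL_le : L ≤ 2 * N₀ := by
    have hmul : L * w t₀ = N t₀ := div_mul_cancel₀ _ (hw_pos t₀).ne'
    have hw_one : 1 ≤ w t₀ := Real.one_le_exp (by positivity)
    nlinarith [h t₀ ht₀]
  exact (hle x right_mem_uIcc).trans (mul_le_mul_of_nonneg_right hL_le (hw_pos x).le)

variable {I : Set ℝ} {A : ℝ → E →L[ℝ] E} {Y F : ℝ → E}

lemma locallyIntegrableOn_clm_apply (hIo : IsOpen I) (hA : LocallyIntegrableOn A I volume)
    (hY : ContinuousOn Y I) : LocallyIntegrableOn (fun t => A t (Y t)) I volume := by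
  rw [locallyIntegrableOn_iff hIo.isLocallyClosed] at hA ⊢
  intro K hKI hK
  obtain ⟨C, hC⟩ := hK.exists_bound_of_continuousOn (hY.mono hKI)
  refine Integrable.mono' (g := fun t => ‖A t‖ * C) ((hA K hKI hK).norm.mul_const C) ?_ ?_
  · exact (ContinuousLinearMap.apply ℝ E).flip.aestronglyMeasurable_comp₂
      (hA K hKI hK).aestronglyMeasurable
      ((hY.mono hKI).aestronglyMeasurable_of_isCompact hK hK.measurableSet)
  · filter_upwards [ae_restrict_mem hK.measurableSet] with t ht
    exact (A t).le_opNorm_of_le (hC t ht)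

/-- The `n`-th term `V ^ n F` of the Neumann series of the Volterra operator
`V Y = ∫ t in c..·, A t (Y t)`; the series solves `Y = F + V Y`. -/
noncomputable def volterraIterate (A : ℝ → E →L[ℝ] E) (F : ℝ → E) (c : ℝ) : ℕ → ℝ → E
  | 0 => F
  | n + 1 => fun x => ∫ t in c..x, A t (volterraIterate A F c n t)

lemma continuousOn_volterraIterate (hI : OrdConnected I) (hIo : IsOpen I) (hc : c ∈ I)
    (hA : LocallyIntegrableOn A I volume) (hF : ContinuousOn F I) :
    ∀ n, ContinuousOn (volterraIterate A F c n) I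
  | 0 => hF
  | n + 1 => continuousOn_intervalIntegral_of_locallyIntegrableOn
      (locallyIntegrableOn_clm_apply hIo hA (continuousOn_volterraIterate hI hIo hc hA hF n))
      hI hIo hc

lemma norm_volterraIterate_le {M : ℝ} (hA : IntervalIntegrable A volume c x)
    (hM : ∀ t ∈ uIcc c x, ‖F t‖ ≤ M) (n : ℕ) :
    ∀ t ∈ uIcc c x,
      ‖volterraIterate A F c n t‖ ≤ M / 2 ^ n * Real.exp (2 * |∫ u in c..t, ‖A u‖|) := by
  have hM₀ : 0 ≤ M := (norm_nonneg _).trans (hM c left_mem_uIcc)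
  induction n with
  | zero =>
    intro t ht
    rw [pow_zero, div_one]
    exact (hM t ht).trans (le_mul_of_one_le_right hM₀ (Real.one_le_exp (by positivity)))
  | succ n ih =>
    intro t ht
    have hsub : uIcc c t ⊆ uIcc c x := uIcc_subset_uIcc left_mem_uIcc ht
    rw [pow_succ, ← div_div]
    refine norm_intervalIntegral_le_of_norm_le_mul_exp (fun _ => norm_nonneg _)
      (hA.norm.mono_set hsub) (by positivity) fun s hs => ?_
    exact (A s).le_opNorm_of_le (ih s (hsub hs))

lemma exists_summable_bound_volterraIterate {α β : ℝ} (hc : c ∈ Icc α β)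
    (hA : IntegrableOn A (Icc α β)) (hF : ContinuousOn F (Icc α β)) :
    ∃ B : ℕ → ℝ, Summable B ∧ ∀ n, ∀ x ∈ Icc α β, ‖volterraIterate A F c n x‖ ≤ B n := by
  obtain ⟨M, hM⟩ := isCompact_Icc.exists_bound_of_continuousOn hF
  have hM₀ : 0 ≤ M := (norm_nonneg _).trans (hM c hc)
  refine ⟨fun n => M / 2 ^ n * Real.exp (2 * ∫ u in Icc α β, ‖A u‖), ?_, fun n x hx => ?_⟩
  · simpa only [div_eq_mul_inv, ← inv_pow] using
      ((summable_geometric_of_lt_one (by norm_num) (by norm_num : (2 : ℝ)⁻¹ < 1)).mul_left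
        M).mul_right _
  · have hsub : uIcc c x ⊆ Icc α β := ordConnected_Icc.uIcc_subset hc hx
    have hle : |∫ u in c..x, ‖A u‖| ≤ ∫ u in Icc α β, ‖A u‖ := by
      rw [← Real.norm_eq_abs, intervalIntegral.norm_integral_eq_norm_integral_uIoc,
        Real.norm_of_nonneg (integral_nonneg fun _ => norm_nonneg _)]
      exact setIntegral_mono_set hA.norm (Eventually.of_forall fun _ => norm_nonneg _)
        (uIoc_subset_uIcc.trans hsub).eventuallyLE
    refine (norm_volterraIterate_le (hA.mono_set hsub).intervalIntegrable
      (fun t ht => hM t (hsub ht)) n x right_mem_uIcc).trans ?_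
    exact mul_le_mul_of_nonneg_left (Real.exp_le_exp.2 (by linarith)) (by positivity)

lemma exists_continuousOn_eq_add_intervalIntegral [CompleteSpace E] (hI : OrdConnected I)
    (hIo : IsOpen I) (hc : c ∈ I) (hA : LocallyIntegrableOn A I volume) (hF : ContinuousOn F I) :
    ∃ Y : ℝ → E, ContinuousOn Y I ∧ ∀ x ∈ I, Y x = F x + ∫ t in c..x, A t (Y t) := by
  let u := volterraIterate A F c
  have hu : ∀ n, ContinuousOn (u n) I := continuousOn_volterraIterate hI hIo hc hA hF
  have hbound : ∀ α ∈ I, ∀ β ∈ I, c ∈ Icc α β →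
      ∃ B : ℕ → ℝ, Summable B ∧ ∀ n, ∀ x ∈ Icc α β, ‖u n x‖ ≤ B n := fun α hα β hβ hcαβ =>
    exists_summable_bound_volterraIterate hcαβ
      (hA.integrableOn_compact_subset (hI.out hα hβ) isCompact_Icc) (hF.mono (hI.out hα hβ))
  refine ⟨fun x => ∑' n, u n x, ?_, fun x hx => ?_⟩
  · refine continuousOn_of_forall_Icc hI hIo hc fun α hα β hβ hcαβ => ?_
    obtain ⟨B, hB, hle⟩ := hbound α hα β hβ hcαβ
    exact continuousOn_tsum (fun n => (hu n).mono (hI.out hα hβ)) hB hle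
  · obtain ⟨α, hα, β, hβ, -, hcαβ, hnhds⟩ := exists_Icc_mem_nhds_of_ordConnected hI hIo hc hx
    obtain ⟨B, hB, hle⟩ := hbound α hα β hβ hcαβ
    have hsum : ∀ t ∈ Icc α β, Summable fun n => u n t := fun t ht =>
      hB.of_norm_bounded fun n => hle n t ht
    have hsub : uIoc c x ⊆ Icc α β :=
      uIoc_subset_uIcc.trans (ordConnected_Icc.uIcc_subset hcαβ (mem_of_mem_nhds hnhds))
    have hAint := (intervalIntegrable_of_locallyIntegrableOn hA hI hc hx).norm
    have hswap : HasSum (fun n => u (n + 1) x) (∫ t in c..x, A t (∑' n, u n t)) := by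
      refine intervalIntegral.hasSum_integral_of_dominated_convergence
        (fun n t => ‖A t‖ * B n) (fun n => ?_) (fun n => ?_) ?_ ?_ ?_
      · exact (intervalIntegrable_iff.1 (intervalIntegrable_of_locallyIntegrableOn
          (locallyIntegrableOn_clm_apply hIo hA (hu n)) hI hc hx)).aestronglyMeasurable
      · exact Eventually.of_forall fun t ht => (A t).le_opNorm_of_le (hle n t (hsub ht))
      · exact Eventually.of_forall fun t _ => hB.mul_left _
      · simpa only [tsum_mul_left] using hAint.mul_const _
      · exact Eventually.of_forall fun t ht => (A t).hasSum (hsum t (hsub ht)).hasSum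
    beta_reduce
    rw [(hsum x (mem_of_mem_nhds hnhds)).tsum_eq_zero_add, ← hswap.tsum_eq]
    rfl

end Volterra

namespace SturmLiouville

variable {τ : SturmLiouville}

/-! ### Local absolute continuity on `(a, b)` -/

lemma nonempty_I (τ : SturmLiouville) : τ.I.Nonempty :=
  EReal.lt_iff_exists_real_btwn.1 τ.a_lt_b

lemma ae_mem_uIoc_of_ae_restrict {P : ℝ → Prop} (h : ∀ᵐ x ∂volume.restrict τ.I, P x) {α β : ℝ}
    (hα : α ∈ τ.I) (hβ : β ∈ τ.I) : ∀ᵐ x, x ∈ uIoc α β → P x := by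
  rw [ae_restrict_iff' τ.measurableSet_I] at h
  filter_upwards [h] with x hx hxm
  exact hx (τ.ordConnected_I.uIcc_subset hα hβ (uIoc_subset_uIcc hxm))

section Primitive

variable {E : Type*} [NormedAddCommGroup E] [NormedSpace ℝ E] {f g : ℝ → E} {c : ℝ} {y : E}

lemma acLoc_clm_comp_of_eq_add_integral (L : E →L[ℝ] ℂ) (hg : LocallyIntegrableOn g τ.I volume)
    (hc : c ∈ τ.I) (h : ∀ x ∈ τ.I, f x = y + ∫ t in c..x, g t) : τ.ACLoc fun x => L (f x) := by
  have hint : ∀ {u v}, u ∈ τ.I → v ∈ τ.I → IntervalIntegrable g volume u v := fun hu hv =>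
    intervalIntegrable_of_locallyIntegrableOn hg τ.ordConnected_I hu hv
  intro α hα β hβ
  have hsub := τ.ordConnected_I.uIcc_subset hα hβ
  refine absolutelyContinuousOnInterval_of_dist_le_mul (K := ‖L‖)
    (absolutelyContinuousOnInterval_intervalIntegral (hint hα hβ) left_mem_uIcc)
    fun u hu v hv => ?_
  rw [dist_eq_norm, dist_eq_norm, ← map_sub, h u (hsub hu), h v (hsub hv),
    add_sub_add_left_eq_sub,
    intervalIntegral.integral_interval_sub_left (hint hc (hsub hu)) (hint hc (hsub hv)),
    intervalIntegral.integral_interval_sub_left (hint hα (hsub hu)) (hint hα (hsub hv))]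
  exact L.le_opNorm _

lemma ae_hasDerivAt_of_eq_add_integral [CompleteSpace E] (hg : LocallyIntegrableOn g τ.I volume)
    (hc : c ∈ τ.I) (h : ∀ x ∈ τ.I, f x = y + ∫ t in c..x, g t) :
    ∀ᵐ x ∂volume.restrict τ.I, HasDerivAt f (g x) x := by
  filter_upwards [ae_hasDerivAt_intervalIntegral_of_locallyIntegrableOn hg τ.ordConnected_I
    τ.isOpen_I hc, ae_restrict_mem τ.measurableSet_I] with x hx hxI
  refine (hx.const_add y).congr_of_eventuallyEq ?_
  filter_upwards [τ.isOpen_I.mem_nhds hxI] with t ht using h t ht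

end Primitive

namespace ACLoc

variable {f g : ℝ → ℂ}

lemma integral_eq_sub_of_ae_hasDerivAt (hf : τ.ACLoc f)
    (h : ∀ᵐ x ∂volume.restrict τ.I, HasDerivAt f (g x) x) {α β : ℝ} (hα : α ∈ τ.I)
    (hβ : β ∈ τ.I) : ∫ x in α..β, g x = f β - f α := by
  rw [← integral_deriv_eq_sub_of_absolutelyContinuous (hf α hα β hβ)]
  exact intervalIntegral.integral_congr_ae
    (ae_mem_uIoc_of_ae_restrict (h.mono fun x hx => hx.deriv.symm) hα hβ)

lemma mul (hf : τ.ACLoc f) (hg : τ.ACLoc g) : τ.ACLoc fun x => f x * g x :=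
  fun α hα β hβ => (hf α hα β hβ).smul (hg α hα β hβ)

lemma sub (hf : τ.ACLoc f) (hg : τ.ACLoc g) : τ.ACLoc fun x => f x - g x :=
  fun α hα β hβ => (hf α hα β hβ).sub (hg α hα β hβ)

lemma star (hf : τ.ACLoc f) : τ.ACLoc fun x => star (f x) := fun α hα β hβ =>
  absolutelyContinuousOnInterval_of_dist_le_mul (K := 1) (hf α hα β hβ) fun x _ y _ => by
    rw [one_mul, dist_star_star]

end ACLoc

/-! ### Quasi-derivatives and Lagrange's identity -/

lemma expr_star (τ : SturmLiouville) (f f₁ : ℝ → ℂ) (x : ℝ) :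
    τ.expr (fun x => star (f x)) (fun x => star (f₁ x)) x = star (τ.expr f f₁ x) := by
  simp only [expr, deriv.star]
  simp

lemma expr_smul (τ : SturmLiouville) (c : ℂ) (f f₁ : ℝ → ℂ) (x : ℝ) :
    τ.expr (c • f) (c • f₁) x = c * τ.expr f f₁ x := by
  simp only [Pi.smul_apply, expr, deriv_const_smul_field, smul_eq_mul]
  ring

lemma ae_p_ne_zero (τ : SturmLiouville) : ∀ᵐ x ∂volume.restrict τ.I, (τ.p x : ℂ) ≠ 0 := by
  filter_upwards [show ∀ᵐ x ∂volume.restrict τ.I, τ.p x ≠ 0 from τ.p_ne_zero] with x hx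
  exact_mod_cast hx

lemma ae_r_ne_zero (τ : SturmLiouville) : ∀ᵐ x ∂volume.restrict τ.I, (τ.r x : ℂ) ≠ 0 := by
  filter_upwards [show ∀ᵐ x ∂volume.restrict τ.I, 0 < τ.r x from τ.r_pos] with x hx
  exact Complex.ofReal_ne_zero.2 (ne_of_gt hx)

/-- The modified Wronskian `W(f, g) = f g^[1] - f^[1] g`. -/
def wronskian (f f₁ g g₁ : ℝ → ℂ) (x : ℝ) : ℂ := f x * g₁ x - f₁ x * g x

namespace IsQuasiDeriv

variable {f f₁ g g₁ : ℝ → ℂ}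

lemma ae_hasDerivAt (hf : τ.IsQuasiDeriv f f₁) : ∀ᵐ x ∂volume.restrict τ.I,
    HasDerivAt f ((τ.p x : ℂ)⁻¹ * f₁ x - τ.s x * f x) x := by
  filter_upwards [hf.ac.ae_differentiableAt, hf.eq, τ.ae_p_ne_zero] with x hdiff heq hp
  refine hdiff.hasDerivAt.congr_deriv ?_
  rw [heq]
  field_simp
  ring

lemma ae_hasDerivAt₁ (hf : τ.IsQuasiDeriv f f₁) : ∀ᵐ x ∂volume.restrict τ.I,
    HasDerivAt f₁ (τ.s x * f₁ x + τ.q x * f x - τ.r x * τ.expr f f₁ x) x := by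
  filter_upwards [hf.ac₁.ae_differentiableAt, τ.ae_r_ne_zero] with x hdiff hr
  refine hdiff.hasDerivAt.congr_deriv ?_
  rw [expr]
  field_simp
  ring

lemma star (hf : τ.IsQuasiDeriv f f₁) :
    τ.IsQuasiDeriv (fun x => star (f x)) (fun x => star (f₁ x)) where
  ac := hf.ac.star
  ac₁ := hf.ac₁.star
  eq := by
    filter_upwards [hf.eq] with x hx
    rw [hx, deriv.star]
    simp

lemma expr_add (hf : τ.IsQuasiDeriv f f₁) (hg : τ.IsQuasiDeriv g g₁) :
    ∀ᵐ x ∂volume.restrict τ.I, τ.expr (f + g) (f₁ + g₁) x = τ.expr f f₁ x + τ.expr g g₁ x := by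
  filter_upwards [hf.ac₁.ae_differentiableAt, hg.ac₁.ae_differentiableAt] with x hfx hgx
  simp only [Pi.add_apply, expr, deriv_add hfx hgx]
  ring

lemma eqOn_zero (hf : τ.IsQuasiDeriv f f₁) {U : Set ℝ} (hU : IsOpen U) (hUI : U ⊆ τ.I)
    (h : ∀ᵐ x ∂volume.restrict U, f x = 0) : EqOn f 0 U ∧ EqOn f₁ 0 U := by
  have h0 : EqOn f 0 U := Measure.eqOn_open_of_ae_eq h hU (hf.ac.continuousOn.mono hUI)
    continuousOn_const
  refine ⟨h0, Measure.eqOn_open_of_ae_eq (μ := volume) ?_ hU (hf.ac₁.continuousOn.mono hUI)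
    continuousOn_const⟩
  filter_upwards [ae_mono (Measure.restrict_mono hUI le_rfl) hf.eq,
    ae_restrict_mem hU.measurableSet] with x hx hxU
  rw [hx, (h0.eventuallyEq_of_mem (hU.mem_nhds hxU)).deriv_eq, h0 hxU]
  simp

variable (hf : τ.IsQuasiDeriv f f₁) (hg : τ.IsQuasiDeriv g g₁)

include hf hg

lemma acLoc_wronskian : τ.ACLoc (wronskian f f₁ g g₁) :=
  (hf.ac.mul hg.ac₁).sub (hf.ac₁.mul hg.ac)

lemma ae_hasDerivAt_wronskian : ∀ᵐ x ∂volume.restrict τ.I, HasDerivAt (wronskian f f₁ g g₁)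
    (τ.r x * (τ.expr f f₁ x * g x - f x * τ.expr g g₁ x)) x := by
  filter_upwards [hf.ae_hasDerivAt, hf.ae_hasDerivAt₁, hg.ae_hasDerivAt, hg.ae_hasDerivAt₁]
    with x hfx hfx₁ hgx hgx₁
  refine ((hfx.mul hgx₁).sub (hfx₁.mul hgx)).congr_deriv ?_
  ring

lemma integral_lagrange {α β : ℝ} (hα : α ∈ τ.I) (hβ : β ∈ τ.I) :
    ∫ x in α..β, (τ.r x : ℂ) * (τ.expr f f₁ x * g x - f x * τ.expr g g₁ x) =
      wronskian f f₁ g g₁ β - wronskian f f₁ g g₁ α :=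
  (hf.acLoc_wronskian hg).integral_eq_sub_of_ae_hasDerivAt (hf.ae_hasDerivAt_wronskian hg) hα hβ

end IsQuasiDeriv

/-! ### The initial value problem -/

/-- The coefficient matrix of the first-order system for `(f, f^[1])` equivalent to
`(τ - z) f = 0`. -/
noncomputable def systemMatrix (τ : SturmLiouville) (z : ℂ) (t : ℝ) : ℂ × ℂ →L[ℝ] ℂ × ℂ :=
  let π₁ := ContinuousLinearMap.fst ℝ ℂ ℂ
  let π₂ := ContinuousLinearMap.snd ℝ ℂ ℂ
  let i₁ := ContinuousLinearMap.inl ℝ ℂ ℂ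
  let i₂ := ContinuousLinearMap.inr ℝ ℂ ℂ
  (τ.p t)⁻¹ • i₁ ∘L π₂ + τ.s t • (i₂ ∘L π₂ - i₁ ∘L π₁) + τ.q t • i₂ ∘L π₁ -
    τ.r t • (z • i₂ ∘L π₁)

lemma systemMatrix_apply (z : ℂ) (t : ℝ) (y : ℂ × ℂ) :
    τ.systemMatrix z t y = ((τ.p t : ℂ)⁻¹ * y.2 - τ.s t * y.1,
      τ.s t * y.2 + τ.q t * y.1 - τ.r t * (z * y.1)) := by
  ext <;> simp [systemMatrix, sub_eq_add_neg]

lemma locallyIntegrableOn_systemMatrix (z : ℂ) :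
    LocallyIntegrableOn (τ.systemMatrix z) τ.I volume := by
  have hsmul : ∀ {k : ℝ → ℝ} (B : ℂ × ℂ →L[ℝ] ℂ × ℂ), LocallyIntegrableOn k τ.I volume →
      LocallyIntegrableOn (fun t => k t • B) τ.I volume := fun B hk x hx =>
    (hk x hx).imp fun _ hU => ⟨hU.1, hU.2.smul_const B⟩
  exact (((hsmul _ τ.locInt_inv_p).add (hsmul _ τ.locInt_s)).add (hsmul _ τ.locInt_q)).sub
    (hsmul _ τ.locInt_r)

lemma isQuasiDeriv_of_ae_hasDerivAt {f f₁ : ℝ → ℂ} (hf : τ.ACLoc f) (hf₁ : τ.ACLoc f₁)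
    (h : ∀ᵐ x ∂volume.restrict τ.I, HasDerivAt f ((τ.p x : ℂ)⁻¹ * f₁ x - τ.s x * f x) x) :
    τ.IsQuasiDeriv f f₁ where
  ac := hf
  ac₁ := hf₁
  eq := by
    filter_upwards [h, τ.ae_p_ne_zero] with x hx hp
    rw [hx.deriv]
    field_simp
    ring

lemma ae_expr_eq_of_ae_hasDerivAt {f f₁ g : ℝ → ℂ} (h : ∀ᵐ x ∂volume.restrict τ.I,
      HasDerivAt f₁ (τ.s x * f₁ x + τ.q x * f x - τ.r x * g x) x) :
    ∀ᵐ x ∂volume.restrict τ.I, τ.expr f f₁ x = g x := by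
  filter_upwards [h, τ.ae_r_ne_zero] with x hx hr
  rw [expr, hx.deriv]
  field_simp
  ring

lemma exists_initial_value (z : ℂ) {h : ℝ → ℂ}
    (hh : LocallyIntegrableOn (fun x => (τ.r x : ℂ) * h x) τ.I volume) {c : ℝ} (hc : c ∈ τ.I)
    (d d₁ : ℂ) : ∃ f f₁ : ℝ → ℂ, τ.IsQuasiDeriv f f₁ ∧
      (∀ᵐ x ∂volume.restrict τ.I, τ.expr f f₁ x = z * f x + h x) ∧ f c = d ∧ f₁ c = d₁ := by
  let A := τ.systemMatrix z
  let g : ℝ → ℂ × ℂ := fun x => ContinuousLinearMap.inr ℝ ℂ ℂ (-(τ.r x * h x))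
  have hA : LocallyIntegrableOn A τ.I volume := locallyIntegrableOn_systemMatrix z
  have hg : LocallyIntegrableOn g τ.I volume := fun x hx => (hh x hx).imp fun _ hU =>
    ⟨hU.1, (ContinuousLinearMap.inr ℝ ℂ ℂ).integrable_comp hU.2.neg⟩
  obtain ⟨Y, hY, hYeq⟩ := exists_continuousOn_eq_add_intervalIntegral τ.ordConnected_I τ.isOpen_I
    hc hA (continuousOn_const.add (continuousOn_intervalIntegral_of_locallyIntegrableOn hg
      τ.ordConnected_I τ.isOpen_I hc))
  have hAY := locallyIntegrableOn_clm_apply τ.isOpen_I hA hY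
  have hYeq' : ∀ x ∈ τ.I, Y x = (d, d₁) + ∫ t in c..x, (g t + A t (Y t)) := fun x hx => by
    rw [hYeq x hx, Pi.add_apply, intervalIntegral.integral_add
      (intervalIntegrable_of_locallyIntegrableOn hg τ.ordConnected_I hc hx)
      (intervalIntegrable_of_locallyIntegrableOn hAY τ.ordConnected_I hc hx), add_assoc]
  have hderiv := ae_hasDerivAt_of_eq_add_integral (hg.add hAY) hc hYeq'
  refine ⟨fun x => (Y x).1, fun x => (Y x).2, isQuasiDeriv_of_ae_hasDerivAt
    (acLoc_clm_comp_of_eq_add_integral (.fst ℝ ℂ ℂ) (hg.add hAY) hc hYeq')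
    (acLoc_clm_comp_of_eq_add_integral (.snd ℝ ℂ ℂ) (hg.add hAY) hc hYeq') ?_,
    ae_expr_eq_of_ae_hasDerivAt ?_, by simp [hYeq' c hc], by simp [hYeq' c hc]⟩
  · filter_upwards [hderiv] with x hx
    refine (HasFDerivAt.fst hx).hasDerivAt.congr_deriv ?_
    simp [A, g, systemMatrix_apply]
  · filter_upwards [hderiv] with x hx
    refine (HasFDerivAt.snd hx).hasDerivAt.congr_deriv ?_
    simp [A, g, systemMatrix_apply]
    ring

/-! ### Solutions and fundamental systems -/

/-- `u` is a solution of `(τ - z) u = 0` and `u₁` is its first quasi-derivative. -/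
structure IsSolPair (τ : SturmLiouville) (z : ℂ) (u u₁ : ℝ → ℂ) : Prop where
  qd : τ.IsQuasiDeriv u u₁
  eq : ∀ᵐ x ∂volume.restrict τ.I, τ.expr u u₁ x = z * u x

lemma isSolution_iff_exists_isSolPair {z : ℂ} {u : ℝ → ℂ} :
    τ.IsSolution z u ↔ ∃ u₁, τ.IsSolPair z u u₁ := by
  simp only [IsSolution, sub_eq_zero]
  exact exists_congr fun _ => ⟨fun h => ⟨h.1, h.2⟩, fun h => ⟨h.qd, h.eq⟩⟩

namespace IsSolPair

variable {z : ℂ} {u u₁ v v₁ : ℝ → ℂ}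

lemma add (hu : τ.IsSolPair z u u₁) (hv : τ.IsSolPair z v v₁) :
    τ.IsSolPair z (u + v) (u₁ + v₁) where
  qd := hu.qd.add hv.qd
  eq := by
    filter_upwards [hu.eq, hv.eq, hu.qd.expr_add hv.qd] with x hux hvx hadd
    rw [hadd, hux, hvx, Pi.add_apply, mul_add]

lemma smul (c : ℂ) (hu : τ.IsSolPair z u u₁) : τ.IsSolPair z (c • u) (c • u₁) where
  qd := hu.qd.smul c
  eq := by
    filter_upwards [hu.eq] with x hux
    rw [expr_smul, hux, Pi.smul_apply, smul_eq_mul, mul_left_comm]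

lemma star (hu : τ.IsSolPair z u u₁) :
    τ.IsSolPair (star z) (fun x => star (u x)) (fun x => star (u₁ x)) where
  qd := hu.qd.star
  eq := by
    filter_upwards [hu.eq] with x hux
    rw [expr_star, hux, star_mul']

lemma wronskian_sub {f f₁ h : ℝ → ℂ} (hu : τ.IsSolPair z u u₁) (hf : τ.IsQuasiDeriv f f₁)
    (hfh : ∀ᵐ x ∂volume.restrict τ.I, τ.expr f f₁ x = z * f x + h x) {α β : ℝ}
    (hα : α ∈ τ.I) (hβ : β ∈ τ.I) :
    wronskian f f₁ u u₁ β - wronskian f f₁ u u₁ α = ∫ x in α..β, (τ.r x : ℂ) * (h x * u x) := by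
  rw [← hf.integral_lagrange hu.qd hα hβ]
  refine intervalIntegral.integral_congr_ae (ae_mem_uIoc_of_ae_restrict ?_ hα hβ)
  filter_upwards [hu.eq, hfh] with x hux hfx
  rw [hux, hfx]
  ring

lemma wronskian_eq (hu : τ.IsSolPair z u u₁) (hv : τ.IsSolPair z v v₁) {α β : ℝ}
    (hα : α ∈ τ.I) (hβ : β ∈ τ.I) : wronskian v v₁ u u₁ β = wronskian v v₁ u u₁ α := by
  have := hu.wronskian_sub hv.qd (h := 0) (by simpa using hv.eq) hα hβ
  simpa [sub_eq_zero] using this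

end IsSolPair

/-- A fundamental system of `(τ - z) u = 0`: solutions `θ` and `φ` with quasi-derivatives `θ₁` and
`φ₁`, normalised by `θ(c) = φ^[1](c) = 1` and `θ^[1](c) = φ(c) = 0`. -/
structure FundamentalSystem (τ : SturmLiouville) (z : ℂ) (c : ℝ) where
  θ : ℝ → ℂ
  θ₁ : ℝ → ℂ
  φ : ℝ → ℂ
  φ₁ : ℝ → ℂ
  mem : c ∈ τ.I
  sol_θ : τ.IsSolPair z θ θ₁
  sol_φ : τ.IsSolPair z φ φ₁
  θ_c : θ c = 1
  θ₁_c : θ₁ c = 0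
  φ_c : φ c = 0
  φ₁_c : φ₁ c = 1

lemma nonempty_fundamentalSystem (z : ℂ) {c : ℝ} (hc : c ∈ τ.I) :
    Nonempty (τ.FundamentalSystem z c) := by
  have h0 : LocallyIntegrableOn (fun x => (τ.r x : ℂ) * (0 : ℝ → ℂ) x) τ.I volume := by
    simpa using locallyIntegrableOn_zero
  obtain ⟨θ, θ₁, hθ, hθ_eq, hθc, hθ₁c⟩ := exists_initial_value z h0 hc 1 0
  obtain ⟨φ, φ₁, hφ, hφ_eq, hφc, hφ₁c⟩ := exists_initial_value z h0 hc 0 1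
  exact ⟨⟨θ, θ₁, φ, φ₁, hc, ⟨hθ, by simpa using hθ_eq⟩, ⟨hφ, by simpa using hφ_eq⟩,
    hθc, hθ₁c, hφc, hφ₁c⟩⟩

namespace FundamentalSystem

variable {z : ℂ} {c : ℝ} (S : τ.FundamentalSystem z c)

lemma wronskian_eq_one {x : ℝ} (hx : x ∈ τ.I) : S.θ x * S.φ₁ x - S.θ₁ x * S.φ x = 1 := by
  have := S.sol_φ.wronskian_eq S.sol_θ S.mem hx
  simpa [wronskian, S.θ_c, S.θ₁_c, S.φ_c, S.φ₁_c] using this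

/-- The solution with initial values `v` at `c`, as a linear function of `v`. -/
noncomputable def solution : ℂ × ℂ →ₗ[ℂ] ℝ → ℂ :=
  (LinearMap.toSpanSingleton ℂ _ S.θ).coprod (LinearMap.toSpanSingleton ℂ _ S.φ)

/-- The first quasi-derivative of `S.solution v`. -/
noncomputable def solution₁ : ℂ × ℂ →ₗ[ℂ] ℝ → ℂ :=
  (LinearMap.toSpanSingleton ℂ _ S.θ₁).coprod (LinearMap.toSpanSingleton ℂ _ S.φ₁)

lemma solution_apply (v : ℂ × ℂ) (x : ℝ) : S.solution v x = v.1 * S.θ x + v.2 * S.φ x := rfl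

lemma solution₁_apply (v : ℂ × ℂ) (x : ℝ) : S.solution₁ v x = v.1 * S.θ₁ x + v.2 * S.φ₁ x := rfl

lemma isSolPair_solution (v : ℂ × ℂ) : τ.IsSolPair z (S.solution v) (S.solution₁ v) :=
  (S.sol_θ.smul v.1).add (S.sol_φ.smul v.2)

lemma eq_wronskian_mul_sub (f f₁ : ℝ → ℂ) {x : ℝ} (hx : x ∈ τ.I) :
    f x = wronskian f f₁ S.φ S.φ₁ x * S.θ x - wronskian f f₁ S.θ S.θ₁ x * S.φ x := by
  simp only [wronskian]
  linear_combination (-f x) * S.wronskian_eq_one hx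

lemma eq_solution {u u₁ : ℝ → ℂ} (hu : τ.IsSolPair z u u₁) {x : ℝ} (hx : x ∈ τ.I) :
    u x = S.solution (u c, u₁ c) x := by
  rw [S.eq_wronskian_mul_sub u u₁ hx, S.sol_φ.wronskian_eq hu S.mem hx,
    S.sol_θ.wronskian_eq hu S.mem hx, solution_apply]
  simp [wronskian, S.θ_c, S.θ₁_c, S.φ_c, S.φ₁_c]

lemma eq_zero_of_solution_eq_zero {v : ℂ × ℂ} {x : ℝ} (hx : x ∈ τ.I) (h : S.solution v x = 0)
    (h₁ : S.solution₁ v x = 0) : v = 0 := by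
  have hW := S.wronskian_eq_one hx
  rw [solution_apply] at h
  rw [solution₁_apply] at h₁
  have h1 : v.1 = 0 := by linear_combination (-v.1) * hW + S.φ₁ x * h - S.φ x * h₁
  have h2 : v.2 = 0 := by linear_combination (-v.2) * hW - S.θ₁ x * h + S.θ x * h₁
  exact Prod.ext h1 h2

lemma eq_zero_of_ae_eq_zero {v : ℂ × ℂ} {U : Set ℝ} (hU : IsOpen U) (hUI : U ⊆ τ.I)
    (hne : U.Nonempty) (h : ∀ᵐ x ∂volume.restrict U, S.solution v x = 0) : v = 0 := by
  obtain ⟨h0, h1⟩ := (S.isSolPair_solution v).qd.eqOn_zero hU hUI h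
  obtain ⟨x, hx⟩ := hne
  exact S.eq_zero_of_solution_eq_zero (hUI hx) (h0 hx) (h1 hx)

end FundamentalSystem

end SturmLiouville

/-! ### Square integrability with respect to `r(x) dx` -/

section Nonneg

variable {J : Set ℝ} {g : ℝ → ℝ} {c M : ℝ}

lemma abs_intervalIntegral_eq_setIntegral (hJ : J.OrdConnected)
    (hg₀ : ∀ᵐ x ∂volume.restrict J, 0 ≤ g x) {x y : ℝ} (hx : x ∈ J) (hy : y ∈ J) :
    |∫ t in x..y, g t| = ∫ t in uIoc x y, g t := by
  rw [← Real.norm_eq_abs, intervalIntegral.norm_integral_eq_norm_integral_uIoc,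
    Real.norm_of_nonneg]
  exact integral_nonneg_of_ae
    (ae_restrict_of_ae_restrict_of_subset (uIoc_subset_uIcc.trans (hJ.uIcc_subset hx hy)) hg₀)

lemma abs_intervalIntegral_le_setIntegral (hJ : J.OrdConnected)
    (hg₀ : ∀ᵐ x ∂volume.restrict J, 0 ≤ g x) (hg : IntegrableOn g J) {x y : ℝ} (hx : x ∈ J)
    (hy : y ∈ J) : |∫ t in x..y, g t| ≤ ∫ t in J, g t := by
  rw [abs_intervalIntegral_eq_setIntegral hJ hg₀ hx hy]
  exact setIntegral_mono_set hg hg₀ (uIoc_subset_uIcc.trans (hJ.uIcc_subset hx hy)).eventuallyLE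

lemma lintegral_enorm_uIcc_le_of_abs_intervalIntegral_le (hJ : J.OrdConnected)
    (hg : LocallyIntegrableOn g J) (hg₀ : ∀ᵐ x ∂volume.restrict J, 0 ≤ g x) (hc : c ∈ J)
    (hM : ∀ x ∈ J, |∫ t in c..x, g t| ≤ M) {x y : ℝ} (hx : x ∈ J) (hy : y ∈ J) :
    ∫⁻ t in uIcc x y, ‖g t‖ₑ ≤ ENNReal.ofReal (M + M) := by
  have hint {u v : ℝ} (hu : u ∈ J) (hv : v ∈ J) : IntervalIntegrable g volume u v :=
    (intervalIntegrable_iff').2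
      (hg.integrableOn_compact_subset (hJ.uIcc_subset hu hv) isCompact_uIcc)
  have habs : ∀ᵐ t ∂volume.restrict (uIoc x y), ‖g t‖ = g t :=
    (ae_restrict_of_ae_restrict_of_subset (uIoc_subset_uIcc.trans (hJ.uIcc_subset hx hy)) hg₀).mono
      fun _ => Real.norm_of_nonneg
  rw [← ofReal_integral_norm_eq_lintegral_enorm ((intervalIntegrable_iff').1 (hint hx hy)), uIcc,
    integral_Icc_eq_integral_Ioc]
  refine ENNReal.ofReal_le_ofReal ?_
  calc ∫ t in uIoc x y, ‖g t‖
      = |∫ t in x..y, g t| := by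
        rw [integral_congr_ae habs, abs_intervalIntegral_eq_setIntegral hJ hg₀ hx hy]
    _ = |(∫ t in c..y, g t) - ∫ t in c..x, g t| := by
        rw [intervalIntegral.integral_interval_sub_left (hint hc hy) (hint hc hx)]
    _ ≤ M + M := (abs_sub _ _).trans (add_le_add (hM y hy) (hM x hx))

lemma integrableOn_of_abs_intervalIntegral_le (hJ : J.OrdConnected)
    (hg : LocallyIntegrableOn g J) (hg₀ : ∀ᵐ x ∂volume.restrict J, 0 ≤ g x) (hc : c ∈ J)
    (hM : ∀ x ∈ J, |∫ t in c..x, g t| ≤ M) : IntegrableOn g J := by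
  refine ⟨hg.aestronglyMeasurable, ?_⟩
  rw [hasFiniteIntegral_iff_enorm, ← withDensity_apply' (‖g ·‖ₑ)]
  -- The bound on compact subsets of `J` passes to `J` by inner regularity of `|g| dx`.
  have : SigmaFinite (volume.withDensity (‖g ·‖ₑ)) :=
    SigmaFinite.withDensity_of_ne_top (Eventually.of_forall fun _ => enorm_ne_top)
  rw [hJ.measurableSet.measure_eq_iSup_isCompact]
  refine (iSup₂_le fun K hKJ => iSup_le fun hK => ?_ :
    _ ≤ ENNReal.ofReal (M + M)).trans_lt ENNReal.ofReal_lt_top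
  rcases K.eq_empty_or_nonempty with rfl | hne
  · simp
  rw [withDensity_apply']
  refine (lintegral_mono_set fun t ht => ?_).trans
    (lintegral_enorm_uIcc_le_of_abs_intervalIntegral_le hJ hg hg₀ hc hM
      (hKJ (hK.sInf_mem hne)) (hKJ (hK.sSup_mem hne)))
  exact Icc_subset_uIcc ⟨csInf_le hK.bddBelow ht, le_csSup hK.bddAbove ht⟩

end Nonneg

namespace SturmLiouville

variable {τ : SturmLiouville} {J : Set ℝ} {f : ℝ → ℂ}

lemma aemeasurable_ofReal_r (τ : SturmLiouville) :
    AEMeasurable (fun x => ENNReal.ofReal (τ.r x)) (volume.restrict τ.I) :=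
  τ.locInt_r.aestronglyMeasurable.aemeasurable.ennreal_ofReal

lemma ae_r_pos (τ : SturmLiouville) : ∀ᵐ x ∂volume.restrict τ.I, 0 < τ.r x := τ.r_pos

lemma volume_restrict_I_absolutelyContinuous_μ (τ : SturmLiouville) :
    volume.restrict τ.I ≪ τ.μ := fun _ hs => by
  rw [← compl_mem_ae_iff] at hs ⊢
  exact τ.ae_μ_iff.1 hs

lemma restrict_μ (hJ : MeasurableSet J) (hJI : J ⊆ τ.I) :
    τ.μ.restrict J = (volume.restrict J).withDensity fun x => ENNReal.ofReal (τ.r x) := by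
  rw [μ, restrict_withDensity hJ, Measure.restrict_restrict hJ, inter_eq_left.2 hJI]

lemma restrict_I_μ (τ : SturmLiouville) : τ.μ.restrict τ.I = τ.μ := by
  rw [restrict_μ τ.measurableSet_I subset_rfl, μ]

lemma integral_μ (τ : SturmLiouville) (g : ℝ → ℂ) :
    ∫ x, g x ∂τ.μ = ∫ x in τ.I, (τ.r x : ℂ) * g x := by
  rw [μ, integral_withDensity_eq_integral_toReal_smul₀ τ.aemeasurable_ofReal_r (by simp)]
  refine integral_congr_ae ?_
  filter_upwards [τ.ae_r_pos] with x hx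
  rw [ENNReal.toReal_ofReal hx.le, Complex.real_smul]

lemma memLp_two_iff_integrableOn (hJ : MeasurableSet J) (hJI : J ⊆ τ.I)
    (hf : AEStronglyMeasurable f (volume.restrict J)) :
    MemLp f 2 (τ.μ.restrict J) ↔ IntegrableOn (fun x => τ.r x * ‖f x‖ ^ 2) J volume := by
  rw [restrict_μ hJ hJI, memLp_two_iff_integrable_sq_norm
    (hf.mono_ac (withDensity_absolutelyContinuous _ _)),
    integrable_withDensity_iff_integrable_smul₀'
    (τ.aemeasurable_ofReal_r.mono_measure (Measure.restrict_mono hJI le_rfl)) (by simp)]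
  refine integrable_congr ?_
  filter_upwards [ae_restrict_of_ae_restrict_of_subset hJI τ.ae_r_pos] with x hx
  rw [ENNReal.toReal_ofReal hx.le, smul_eq_mul]

lemma memLp_two_iff_of_continuousOn (hf : ContinuousOn f τ.I) (hJ : MeasurableSet J)
    (hJI : J ⊆ τ.I) :
    MemLp f 2 (τ.μ.restrict J) ↔ IntegrableOn (fun x => τ.r x * ‖f x‖ ^ 2) J volume :=
  memLp_two_iff_integrableOn hJ hJI ((hf.mono hJI).aestronglyMeasurable hJ)

lemma locallyIntegrableOn_r_mul {h : ℝ → ℂ} (hh : MemLp h 2 τ.μ) :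
    LocallyIntegrableOn (fun x => (τ.r x : ℂ) * h x) τ.I volume := by
  have hm : AEStronglyMeasurable h (volume.restrict τ.I) :=
    hh.1.mono_ac τ.volume_restrict_I_absolutelyContinuous_μ
  have hsq : IntegrableOn (fun x => τ.r x * ‖h x‖ ^ 2) τ.I volume :=
    (memLp_two_iff_integrableOn τ.measurableSet_I subset_rfl hm).1 (hh.restrict _)
  have hdom : LocallyIntegrableOn (fun x => τ.r x + τ.r x * ‖h x‖ ^ 2) τ.I volume :=
    τ.locInt_r.add hsq.locallyIntegrableOn
  rw [locallyIntegrableOn_iff τ.isOpen_I.isLocallyClosed] at hdom ⊢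
  have hmeas := (Complex.continuous_ofReal.comp_aestronglyMeasurable
    τ.locInt_r.aestronglyMeasurable).mul hm
  refine fun K hKI hK => (hdom K hKI hK).mono'
    (hmeas.mono_measure (Measure.restrict_mono hKI le_rfl)) ?_
  filter_upwards [ae_restrict_of_ae_restrict_of_subset hKI τ.ae_r_pos] with x hx
  calc ‖(τ.r x : ℂ) * h x‖ = τ.r x * ‖h x‖ := by
        rw [norm_mul, Complex.norm_real, Real.norm_of_nonneg hx.le]
    _ ≤ τ.r x * (1 + ‖h x‖ ^ 2) := by
        gcongr
        nlinarith [sq_nonneg (‖h x‖ - 1), sq_nonneg ‖h x‖]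
    _ = τ.r x + τ.r x * ‖h x‖ ^ 2 := by ring

lemma locallyIntegrableOn_r_mul_continuousOn {N : ℝ → ℝ} (hN : ContinuousOn N τ.I) :
    LocallyIntegrableOn (fun x => τ.r x * N x) τ.I volume := by
  have hr := (locallyIntegrableOn_iff τ.isOpen_I.isLocallyClosed).1 τ.locInt_r
  rw [locallyIntegrableOn_iff τ.isOpen_I.isLocallyClosed]
  exact fun K hKI hK => (hr K hKI hK).mul_continuousOn (hN.mono hKI) hK

lemma locallyIntegrableOn_r_mul_norm_sq (hf : ContinuousOn f τ.I) :
    LocallyIntegrableOn (fun x => τ.r x * ‖f x‖ ^ 2) τ.I volume :=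
  locallyIntegrableOn_r_mul_continuousOn (hf.norm.pow 2)

lemma memLp_restrict_of_isCompact (hf : ContinuousOn f τ.I) {K : Set ℝ} (hK : IsCompact K)
    (hKI : K ⊆ τ.I) : MemLp f 2 (τ.μ.restrict K) :=
  (memLp_two_iff_of_continuousOn hf hK.measurableSet hKI).2
    ((locallyIntegrableOn_r_mul_norm_sq hf).integrableOn_compact_subset hKI hK)

lemma memLp_of_subset_union (hf : ContinuousOn f τ.I) {J₁ J₂ : Set ℝ} (hJ₁m : MeasurableSet J₁)
    (hJ₂m : MeasurableSet J₂) (hJ₁ : J₁ ⊆ τ.I) (hJ₂ : J₂ ⊆ τ.I) (hJ : J ∩ τ.I ⊆ J₁ ∪ J₂)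
    (h₁ : MemLp f 2 (τ.μ.restrict J₁)) (h₂ : MemLp f 2 (τ.μ.restrict J₂)) :
    MemLp f 2 (τ.μ.restrict J) := by
  rw [memLp_two_iff_of_continuousOn hf hJ₁m hJ₁] at h₁
  rw [memLp_two_iff_of_continuousOn hf hJ₂m hJ₂] at h₂
  refine ((memLp_two_iff_of_continuousOn hf (hJ₁m.union hJ₂m) (union_subset hJ₁ hJ₂)).2
    (h₁.union h₂)).mono_measure ?_
  rw [← τ.restrict_I_μ, Measure.restrict_restrict' τ.measurableSet_I, τ.restrict_I_μ]
  exact Measure.restrict_mono hJ le_rfl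

/-! ### The two endpoints -/

/-- A label for the endpoints of `(a, b)`, so that both can be treated by the same argument. -/
inductive Endpoint
  | a
  | b

/-- `f` lies in `L²((a, b); r(x) dx)` near the endpoint `e`. -/
def L2Near (τ : SturmLiouville) : Endpoint → (ℝ → ℂ) → Prop
  | .a => τ.L2NearA
  | .b => τ.L2NearB

/-- `τ` is in the limit-circle case at the endpoint `e`. -/
def LimitCircle (τ : SturmLiouville) (e : Endpoint) : Prop :=
  ∀ z u, τ.IsSolution z u → τ.L2Near e u

/-- The part of `(a, b)` between `c` and the endpoint `e`, with `c`. -/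
def side (τ : SturmLiouville) (c : ℝ) : Endpoint → Set ℝ
  | .a => τ.I ∩ Iic c
  | .b => τ.I ∩ Ici c

lemma side_subset (τ : SturmLiouville) (c : ℝ) : ∀ e, τ.side c e ⊆ τ.I
  | .a => inter_subset_left
  | .b => inter_subset_left

lemma ordConnected_side (τ : SturmLiouville) (c : ℝ) : ∀ e, (τ.side c e).OrdConnected
  | .a => τ.ordConnected_I.inter ordConnected_Iic
  | .b => τ.ordConnected_I.inter ordConnected_Ici

lemma measurableSet_side (τ : SturmLiouville) (c : ℝ) (e : Endpoint) :
    MeasurableSet (τ.side c e) :=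
  (τ.ordConnected_side c e).measurableSet

lemma mem_side {c : ℝ} (hc : c ∈ τ.I) : ∀ e, c ∈ τ.side c e
  | .a => ⟨hc, self_mem_Iic⟩
  | .b => ⟨hc, self_mem_Ici⟩

lemma l2Near_iff_memLp (hf : ContinuousOn f τ.I) {c : ℝ} (hc : c ∈ τ.I) (e : Endpoint) :
    τ.L2Near e f ↔ MemLp f 2 (τ.μ.restrict (τ.side c e)) := by
  refine ⟨fun h => ?_, fun h => ?_⟩
  · obtain ⟨l, u, ⟨hlc, hcu⟩, hI⟩ := mem_nhds_iff_exists_Ioo_subset.1 (τ.isOpen_I.mem_nhds hc)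
    obtain ⟨l', hll', hl'c⟩ := exists_between hlc
    obtain ⟨u', hcu', hu'u⟩ := exists_between hcu
    cases e
    · exact (h u' (hI ⟨hlc.trans hcu', hu'u⟩)).mono_measure
        (Measure.restrict_mono (fun x hx => hx.2.trans_lt hcu') le_rfl)
    · exact (h l' (hI ⟨hll', hl'c.trans hcu⟩)).mono_measure
        (Measure.restrict_mono (fun x hx => hl'c.trans_le hx.2) le_rfl)
  · have union_uIcc {J : Set ℝ} {d : ℝ} (hd : d ∈ τ.I) (hJ : J ∩ τ.I ⊆ τ.side c e ∪ uIcc c d) :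
        MemLp f 2 (τ.μ.restrict J) :=
      have hcd := τ.ordConnected_I.uIcc_subset hc hd
      memLp_of_subset_union hf (τ.measurableSet_side c e) measurableSet_uIcc (τ.side_subset c e)
        hcd hJ h (memLp_restrict_of_isCompact hf isCompact_uIcc hcd)
    cases e <;> refine fun d hd => union_uIcc hd fun x hx => ?_
    · exact (le_total x c).imp (fun hxc => ⟨hx.2, hxc⟩)
        fun hcx => Icc_subset_uIcc ⟨hcx, (mem_Iio.1 hx.1).le⟩
    · exact (le_total c x).imp (fun hcx => ⟨hx.2, hcx⟩)
        fun hxc => Icc_subset_uIcc' ⟨(mem_Ioi.1 hx.1).le, hxc⟩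

lemma memLp_of_forall_side (hf : ContinuousOn f τ.I) {c : ℝ}
    (h : ∀ e, MemLp f 2 (τ.μ.restrict (τ.side c e))) : MemLp f 2 τ.μ := by
  rw [← τ.restrict_I_μ]
  exact memLp_of_subset_union hf (τ.measurableSet_side c .a) (τ.measurableSet_side c .b)
    (τ.side_subset c .a) (τ.side_subset c .b)
    (fun x hx => (le_total x c).imp (fun h => ⟨hx.1, h⟩) fun h => ⟨hx.1, h⟩) (h .a) (h .b)

end SturmLiouville

/-! ### Weyl's alternative -/

namespace SturmLiouville

variable {τ : SturmLiouville}

lemma integrableOn_abs_r_mul_uIoc {N : ℝ → ℝ} (hN : ContinuousOn N τ.I) {α β : ℝ} (hα : α ∈ τ.I)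
    (hβ : β ∈ τ.I) : IntegrableOn (fun x => |τ.r x| * N x) (uIoc α β) := by
  have hsub := τ.ordConnected_I.uIcc_subset hα hβ
  exact ((τ.locInt_r.norm.integrableOn_compact_subset hsub isCompact_uIcc).mul_continuousOn
    (hN.mono hsub) isCompact_uIcc).mono_set uIoc_subset_uIcc

lemma IsSolPair.norm_wronskian_le {z : ℂ} {u u₁ f f₁ h : ℝ → ℂ} (hu : τ.IsSolPair z u u₁)
    (hf : τ.IsQuasiDeriv f f₁)
    (hfh : ∀ᵐ x ∂volume.restrict τ.I, τ.expr f f₁ x = z * f x + h x) {α β : ℝ}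
    (hα : α ∈ τ.I) (hβ : β ∈ τ.I) :
    ‖wronskian f f₁ u u₁ β‖ ≤
      ‖wronskian f f₁ u u₁ α‖ + ∫ x in uIoc α β, |τ.r x| * (‖h x‖ * ‖u x‖) := by
  have hsub := hu.wronskian_sub hf hfh hα hβ
  refine (norm_le_norm_add_norm_sub' _ (wronskian f f₁ u u₁ α)).trans (add_le_add_right ?_ _)
  rw [hsub, intervalIntegral.norm_integral_eq_norm_integral_uIoc]
  refine (norm_integral_le_integral_norm _).trans_eq ?_
  simp only [norm_mul, Complex.norm_real, Real.norm_eq_abs]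

namespace FundamentalSystem

variable {z z' : ℂ} {c : ℝ} (S : τ.FundamentalSystem z c) {u u₁ : ℝ → ℂ} {J : Set ℝ}

/-- The pointwise size of the fundamental system. -/
noncomputable def size (x : ℝ) : ℝ := ‖S.θ x‖ + ‖S.φ x‖

/-- The size of the coefficients of a function `u` with quasi-derivative `u₁` when it is expanded
with respect to the fundamental system by variation of constants. -/
noncomputable def coeffSize (u u₁ : ℝ → ℂ) (x : ℝ) : ℝ :=
  ‖wronskian u u₁ S.φ S.φ₁ x‖ + ‖wronskian u u₁ S.θ S.θ₁ x‖

lemma size_nonneg (x : ℝ) : 0 ≤ S.size x := by unfold size; positivity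

lemma coeffSize_nonneg (u u₁ : ℝ → ℂ) (x : ℝ) : 0 ≤ S.coeffSize u u₁ x := by
  unfold coeffSize; positivity

lemma continuousOn_size : ContinuousOn S.size τ.I :=
  S.sol_θ.qd.ac.continuousOn.norm.add S.sol_φ.qd.ac.continuousOn.norm

lemma continuousOn_coeffSize (hu : τ.IsQuasiDeriv u u₁) : ContinuousOn (S.coeffSize u u₁) τ.I :=
  (hu.acLoc_wronskian S.sol_φ.qd).continuousOn.norm.add
    (hu.acLoc_wronskian S.sol_θ.qd).continuousOn.norm

lemma norm_le_coeffSize_mul_size (u u₁ : ℝ → ℂ) {x : ℝ} (hx : x ∈ τ.I) :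
    ‖u x‖ ≤ S.coeffSize u u₁ x * S.size x := by
  calc ‖u x‖ ≤ ‖wronskian u u₁ S.φ S.φ₁ x‖ * ‖S.θ x‖ + ‖wronskian u u₁ S.θ S.θ₁ x‖ * ‖S.φ x‖ := by
        rw [S.eq_wronskian_mul_sub u u₁ hx, ← norm_mul, ← norm_mul]
        exact norm_sub_le _ _
    _ ≤ S.coeffSize u u₁ x * ‖S.θ x‖ + S.coeffSize u u₁ x * ‖S.φ x‖ := by
        unfold coeffSize
        gcongr <;> simp
    _ = S.coeffSize u u₁ x * S.size x := by rw [size, mul_add]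

lemma coeffSize_le_add_abs_intervalIntegral (hu : τ.IsSolPair z' u u₁) {t : ℝ} (ht : t ∈ τ.I) :
    S.coeffSize u u₁ t ≤ S.coeffSize u u₁ c +
      |∫ x in c..t, |τ.r x| * (‖z' - z‖ * S.size x ^ 2) * S.coeffSize u u₁ x| := by
  have hsub := τ.ordConnected_I.uIcc_subset S.mem ht
  have heq : ∀ᵐ x ∂volume.restrict τ.I, τ.expr u u₁ x = z * u x + (z' - z) * u x := by
    filter_upwards [hu.eq] with x hx
    rw [hx]
    ring
  have hint {w : ℝ → ℂ} (hw : ContinuousOn w τ.I) :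
      IntegrableOn (fun x => |τ.r x| * (‖(z' - z) * u x‖ * ‖w x‖)) (uIoc c t) :=
    integrableOn_abs_r_mul_uIoc
      ((continuousOn_const.mul hu.qd.ac.continuousOn).norm.mul hw.norm) S.mem ht
  have hφ := S.sol_φ.norm_wronskian_le hu.qd heq S.mem ht
  have hθ := S.sol_θ.norm_wronskian_le hu.qd heq S.mem ht
  have hsum := integral_add (hint S.sol_φ.qd.ac.continuousOn) (hint S.sol_θ.qd.ac.continuousOn)
  suffices h : ∫ x in uIoc c t, (|τ.r x| * (‖(z' - z) * u x‖ * ‖S.φ x‖) +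
      |τ.r x| * (‖(z' - z) * u x‖ * ‖S.θ x‖)) ≤
      |∫ x in c..t, |τ.r x| * (‖z' - z‖ * S.size x ^ 2) * S.coeffSize u u₁ x| by
    unfold coeffSize at h ⊢
    linarith
  rw [abs_intervalIntegral_eq_setIntegral ordConnected_univ
    (Eventually.of_forall fun x => mul_nonneg
      (mul_nonneg (abs_nonneg _) (mul_nonneg (norm_nonneg _) (sq_nonneg _)))
      (S.coeffSize_nonneg u u₁ x)) (mem_univ c) (mem_univ t)]
  have hint' := integrableOn_abs_r_mul_uIoc (((S.continuousOn_size.pow 2).const_mul ‖z' - z‖).mul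
    (S.continuousOn_coeffSize hu.qd)) S.mem ht
  refine setIntegral_mono_on ((hint S.sol_φ.qd.ac.continuousOn).add
    (hint S.sol_θ.qd.ac.continuousOn)) (by simpa [mul_assoc] using hint')
    measurableSet_uIoc fun x hx => ?_
  calc |τ.r x| * (‖(z' - z) * u x‖ * ‖S.φ x‖) + |τ.r x| * (‖(z' - z) * u x‖ * ‖S.θ x‖)
      = |τ.r x| * ‖z' - z‖ * S.size x * ‖u x‖ := by rw [size, norm_mul]; ring
    _ ≤ |τ.r x| * ‖z' - z‖ * S.size x * (S.coeffSize u u₁ x * S.size x) := by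
        have := S.size_nonneg x
        gcongr
        exact S.norm_le_coeffSize_mul_size u u₁ (hsub (uIoc_subset_uIcc hx))
    _ = |τ.r x| * (‖z' - z‖ * S.size x ^ 2) * S.coeffSize u u₁ x := by ring

lemma exists_coeffSize_le (hJ : J.OrdConnected) (hJI : J ⊆ τ.I) (hc : c ∈ J)
    (hS : IntegrableOn (fun x => τ.r x * S.size x ^ 2) J) (hu : τ.IsSolPair z' u u₁) :
    ∃ B, ∀ x ∈ J, S.coeffSize u u₁ x ≤ B := by
  let k : ℝ → ℝ := fun x => |τ.r x| * (‖z' - z‖ * S.size x ^ 2)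
  have hk₀ (x : ℝ) : 0 ≤ k x :=
    mul_nonneg (abs_nonneg _) (mul_nonneg (norm_nonneg _) (sq_nonneg _))
  have hkJ : IntegrableOn k J := by
    refine IntegrableOn.congr_fun (hS.norm.const_mul ‖z' - z‖) (fun x _ => ?_) hJ.measurableSet
    simp only [k, norm_mul, Real.norm_eq_abs, abs_of_nonneg (sq_nonneg (S.size x))]
    ring
  refine ⟨2 * S.coeffSize u u₁ c * Real.exp (2 * ∫ t in J, k t), fun x hx => ?_⟩
  have hsub := hJ.uIcc_subset hc hx
  refine (le_mul_exp_of_le_add_abs_intervalIntegral hk₀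
    (intervalIntegrable_iff.2 (hkJ.mono_set (uIoc_subset_uIcc.trans hsub)))
    ((S.continuousOn_coeffSize hu.qd).mono (hsub.trans hJI)) (S.coeffSize_nonneg u u₁)
    fun t ht => S.coeffSize_le_add_abs_intervalIntegral hu (hJI (hsub ht))).trans ?_
  have hc₀ := S.coeffSize_nonneg u u₁ c
  gcongr
  exact abs_intervalIntegral_le_setIntegral hJ (Eventually.of_forall hk₀) hkJ hc hx

lemma memLp_of_isSolPair (hJ : J.OrdConnected) (hJI : J ⊆ τ.I) (hc : c ∈ J)
    (hθ : MemLp S.θ 2 (τ.μ.restrict J)) (hφ : MemLp S.φ 2 (τ.μ.restrict J))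
    (hu : τ.IsSolPair z' u u₁) : MemLp u 2 (τ.μ.restrict J) := by
  have hsize : MemLp (fun x => (S.size x : ℂ)) 2 (τ.μ.restrict J) := (hθ.norm.add hφ.norm).ofReal
  have hint := (memLp_two_iff_of_continuousOn
    (Complex.continuous_ofReal.comp_continuousOn S.continuousOn_size) hJ.measurableSet hJI).1 hsize
  simp_rw [Function.comp_apply, Complex.norm_real, Real.norm_eq_abs, sq_abs] at hint
  obtain ⟨B, hB⟩ := S.exists_coeffSize_le hJ hJI hc hint hu
  refine hsize.of_le_mul (c := B) ?_ ?_
  · rw [restrict_μ hJ.measurableSet hJI]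
    exact ((hu.qd.ac.continuousOn.mono hJI).aestronglyMeasurable hJ.measurableSet).mono_ac
      (withDensity_absolutelyContinuous _ _)
  · filter_upwards [ae_restrict_mem hJ.measurableSet] with x hx
    rw [Complex.norm_real, Real.norm_of_nonneg (S.size_nonneg x)]
    exact (S.norm_le_coeffSize_mul_size u u₁ (hJI hx)).trans
      (mul_le_mul_of_nonneg_right (hB x hx) (S.size_nonneg x))

lemma continuousOn_solution (v : ℂ × ℂ) : ContinuousOn (S.solution v) τ.I :=
  (S.isSolPair_solution v).qd.ac.continuousOn

/-- The initial values at `c` of the solutions that lie in `L²(J; r(x) dx)`. -/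
def l2Space (J : Set ℝ) : Submodule ℂ (ℂ × ℂ) where
  carrier := {v | MemLp (S.solution v) 2 (τ.μ.restrict J)}
  zero_mem' := by simp
  add_mem' := fun hv hw => by simpa only [mem_ofPred_eq, map_add] using hv.add hw
  smul_mem' := fun t _ hv => by simpa only [mem_ofPred_eq, map_smul] using hv.const_smul t

lemma mem_l2Space {v : ℂ × ℂ} :
    v ∈ S.l2Space J ↔ MemLp (S.solution v) 2 (τ.μ.restrict J) := Iff.rfl

lemma l2Space_eq_top_iff (hJ : J.OrdConnected) (hJI : J ⊆ τ.I) (hc : c ∈ J) :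
    S.l2Space J = ⊤ ↔
      ∀ z' u u₁, τ.IsSolPair z' u u₁ → MemLp u 2 (τ.μ.restrict J) := by
  refine ⟨fun h z' u u₁ hu => S.memLp_of_isSolPair hJ hJI hc ?_ ?_ hu,
    fun h => eq_top_iff.2 fun v _ => h z _ _ (S.isSolPair_solution v)⟩
  · have h10 : (1, 0) ∈ S.l2Space J := h ▸ Submodule.mem_top
    simpa [mem_l2Space, solution] using h10
  · have h01 : (0, 1) ∈ S.l2Space J := h ▸ Submodule.mem_top
    simpa [mem_l2Space, solution] using h01

lemma limitCircle_iff (e : Endpoint) : τ.LimitCircle e ↔ S.l2Space (τ.side c e) = ⊤ := by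
  rw [S.l2Space_eq_top_iff (τ.ordConnected_side c e) (τ.side_subset c e) (mem_side S.mem e)]
  simp only [LimitCircle, isSolution_iff_exists_isSolPair, forall_exists_index]
  exact forall₄_congr fun z' u u₁ hu => l2Near_iff_memLp hu.qd.ac.continuousOn S.mem e

end FundamentalSystem

lemma not_limitCircle_iff (e : Endpoint) :
    ¬ τ.LimitCircle e ↔ ∀ z, ∃ u, τ.IsSolution z u ∧ ¬ τ.L2Near e u := by
  refine ⟨fun h z => ?_, fun h hlc => ?_⟩
  · obtain ⟨c, hc⟩ := τ.nonempty_I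
    obtain ⟨S⟩ := nonempty_fundamentalSystem z hc
    rw [S.limitCircle_iff, Submodule.eq_top_iff', not_forall] at h
    obtain ⟨v, hv⟩ := h
    exact ⟨S.solution v, isSolution_iff_exists_isSolPair.2 ⟨_, S.isSolPair_solution v⟩,
      (l2Near_iff_memLp (S.continuousOn_solution v) hc e).not.2 hv⟩
  · obtain ⟨u, hu, hn⟩ := h 0
    exact hn (hlc 0 u hu)

lemma limitPointA_iff_not_limitCircleA (τ : SturmLiouville) : τ.LimitPointA ↔ ¬ τ.LimitCircleA :=
  (not_limitCircle_iff .a).symm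

lemma limitPointB_iff_not_limitCircleB (τ : SturmLiouville) : τ.LimitPointB ↔ ¬ τ.LimitCircleB :=
  (not_limitCircle_iff .b).symm

end SturmLiouville

/-! ### Square integrable solutions for nonreal spectral parameters -/

namespace SturmLiouville

variable {τ : SturmLiouville}

lemma im_mul_star_sub_of_isSolPair {z : ℂ} {u u₁ : ℝ → ℂ} (hu : τ.IsSolPair z u u₁) {x y : ℝ}
    (hx : x ∈ τ.I) (hy : y ∈ τ.I) :
    (u y * star (u₁ y)).im - (u x * star (u₁ x)).im =
      z.im * ∫ t in x..y, τ.r t * ‖u t‖ ^ 2 := by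
  have hconj : ∀ᵐ t ∂volume.restrict τ.I, τ.expr (fun t => star (u t)) (fun t => star (u₁ t)) t =
      z * star (u t) + (star z - z) * star (u t) := by
    filter_upwards [hu.star.eq] with t ht
    rw [ht]
    ring
  have hW (t : ℝ) : wronskian (fun t => star (u t)) (fun t => star (u₁ t)) u u₁ t =
      ((-2 * (u t * star (u₁ t)).im : ℝ) : ℂ) * Complex.I := by
    apply Complex.ext <;> simp [wronskian] <;> ring
  have hz : star z - z = ((-2 * z.im : ℝ) : ℂ) * Complex.I := by
    apply Complex.ext <;> simp
    ring
  have hnorm (t : ℝ) : (τ.r t : ℂ) * ((star z - z) * star (u t) * u t) =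
      ((-2 * z.im * (τ.r t * ‖u t‖ ^ 2) : ℝ) : ℂ) * Complex.I := by
    have := Complex.conj_mul' (u t)
    rw [hz, mul_assoc, Complex.star_def, this]
    push_cast
    ring
  have h := hu.wronskian_sub hu.star.qd hconj hx hy
  simp only [hW, hnorm] at h
  rw [intervalIntegral.integral_mul_const, intervalIntegral.integral_ofReal, ← sub_mul,
    ← Complex.ofReal_sub, mul_left_inj' Complex.I_ne_zero, Complex.ofReal_inj,
    intervalIntegral.integral_const_mul] at h
  linarith

lemma ae_r_mul_norm_sq_nonneg (τ : SturmLiouville) (f : ℝ → ℂ) :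
    ∀ᵐ x ∂volume.restrict τ.I, 0 ≤ τ.r x * ‖f x‖ ^ 2 := by
  filter_upwards [τ.ae_r_pos] with x hx using by positivity

/-- The orientation of `(a, b)` at the endpoint `e`. -/
def Endpoint.sign : Endpoint → ℝ
  | .a => -1
  | .b => 1

lemma Endpoint.sign_mul_self (e : Endpoint) : e.sign * e.sign = 1 := by
  cases e <;> norm_num [sign]

lemma intervalIntegral_eq_sign_mul {c x : ℝ} {e : Endpoint} (hx : x ∈ τ.side c e) (g : ℝ → ℝ) :
    ∫ t in c..x, g t = e.sign * ∫ t in uIoc c x, g t := by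
  cases e
  · rw [intervalIntegral.integral_of_ge hx.2, uIoc_of_ge hx.2, Endpoint.sign, neg_one_mul]
  · rw [intervalIntegral.integral_of_le hx.2, uIoc_of_le hx.2, Endpoint.sign, one_mul]

lemma mem_uIcc_or_mem_uIcc {c : ℝ} {e : Endpoint} {x y : ℝ} (hx : x ∈ τ.side c e)
    (hy : y ∈ τ.side c e) : x ∈ uIcc c y ∨ y ∈ uIcc c x := by
  cases e
  · exact (le_total y x).imp (fun h => mem_uIcc_of_ge h hx.2) fun h => mem_uIcc_of_ge h hy.2
  · exact (le_total x y).imp (fun h => mem_uIcc_of_le hx.2 h) fun h => mem_uIcc_of_le hy.2 h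

namespace FundamentalSystem

variable {z : ℂ} {c : ℝ} (S : τ.FundamentalSystem z c) {e : Endpoint} {v : ℂ × ℂ} {x y : ℝ}

/-- The form `Im z Im (u conj(u^[1]))(x)` on the space of solutions `u`, with the sign that makes
it increase as `x` moves from `c` towards the endpoint `e`. -/
noncomputable def outwardForm (e : Endpoint) (v : ℂ × ℂ) (x : ℝ) : ℝ :=
  e.sign * z.im * (S.solution v x * star (S.solution₁ v x)).im

lemma outwardForm_sub (v : ℂ × ℂ) (hx : x ∈ τ.side c e) :
    S.outwardForm e v x - S.outwardForm e v c =
      z.im ^ 2 * ∫ t in uIoc c x, τ.r t * ‖S.solution v t‖ ^ 2 := by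
  have h := im_mul_star_sub_of_isSolPair (S.isSolPair_solution v) S.mem (τ.side_subset c e hx)
  rw [intervalIntegral_eq_sign_mul hx] at h
  rw [outwardForm, outwardForm, ← mul_sub, h]
  linear_combination (z.im ^ 2 * ∫ t in uIoc c x, τ.r t * ‖S.solution v t‖ ^ 2) * e.sign_mul_self

lemma outwardForm_le (v : ℂ × ℂ) (hx : x ∈ τ.side c e) (hy : y ∈ τ.side c e)
    (hxy : x ∈ uIcc c y) : S.outwardForm e v x ≤ S.outwardForm e v y := by
  have hsub := τ.ordConnected_I.uIcc_subset S.mem (τ.side_subset c e hy)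
  have hIoc : uIoc c x ⊆ uIoc c y := fun t ht => by
    rw [mem_uIcc] at hxy
    rw [mem_uIoc] at ht ⊢
    grind
  have hmono : ∫ t in uIoc c x, τ.r t * ‖S.solution v t‖ ^ 2 ≤
      ∫ t in uIoc c y, τ.r t * ‖S.solution v t‖ ^ 2 := by
    refine setIntegral_mono_set ?_ (ae_restrict_of_ae_restrict_of_subset
      (uIoc_subset_uIcc.trans hsub) (τ.ae_r_mul_norm_sq_nonneg _))
      hIoc.eventuallyLE
    exact ((locallyIntegrableOn_r_mul_norm_sq
      (S.continuousOn_solution v)).integrableOn_compact_subset hsub isCompact_uIcc).mono_set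
        uIoc_subset_uIcc
  have := mul_le_mul_of_nonneg_left hmono (sq_nonneg z.im)
  linarith [S.outwardForm_sub v hx, S.outwardForm_sub v hy]

lemma continuous_outwardForm (e : Endpoint) (x : ℝ) : Continuous fun v => S.outwardForm e v x := by
  simp only [outwardForm, solution_apply, solution₁_apply]
  fun_prop

lemma outwardForm_smul (t : ℂ) (v : ℂ × ℂ) (x : ℝ) :
    S.outwardForm e (t • v) x = ‖t‖ ^ 2 * S.outwardForm e v x := by
  have hsq : t * S.solution v x * star (t * S.solution₁ v x) =
      ((‖t‖ ^ 2 : ℝ) : ℂ) * (S.solution v x * star (S.solution₁ v x)) := by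
    rw [star_mul', mul_mul_mul_comm, Complex.star_def, Complex.mul_conj',
      Complex.ofReal_pow]
  simp only [outwardForm, map_smul, Pi.smul_apply, smul_eq_mul, hsq, Complex.im_ofReal_mul]
  ring

lemma exists_norm_eq_one_outwardForm_eq_zero (e : Endpoint) (hx : x ∈ τ.I) :
    ∃ v : ℂ × ℂ, ‖v‖ = 1 ∧ S.outwardForm e v x = 0 := by
  -- the solution with `u x = 1` and `u^[1] x = 0`, up to normalisation
  let v : ℂ × ℂ := (S.φ₁ x, -S.θ₁ x)
  have hv₁ : S.solution₁ v x = 0 := by simp only [v, solution₁_apply]; ring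
  have hv₀ : v ≠ 0 := fun h => by
    have h1 : S.solution v x = 1 := by
      simp only [v, solution_apply]
      linear_combination S.wronskian_eq_one hx
    simp [h] at h1
  refine ⟨((‖v‖⁻¹ : ℝ) : ℂ) • v, ?_, ?_⟩
  · rw [norm_smul, Complex.norm_real, norm_inv, norm_norm, inv_mul_cancel₀ (norm_ne_zero_iff.2 hv₀)]
  · simp [outwardForm, hv₁]

lemma exists_outwardForm_nonpos (e : Endpoint) :
    ∃ v : ℂ × ℂ, v ≠ 0 ∧ ∀ x ∈ τ.side c e, S.outwardForm e v x ≤ 0 := by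
  -- By monotonicity the vectors with nonpositive form at `x` decrease as `x` moves towards `e`;
  -- on the unit sphere they are nonempty compact sets, so they have a common point.
  let K : τ.side c e → Set (ℂ × ℂ) := fun x =>
    Metric.sphere 0 1 ∩ {v | S.outwardForm e v x ≤ 0}
  have hhalf (x : τ.side c e) : IsClosed {v | S.outwardForm e v x ≤ 0} :=
    isClosed_le (S.continuous_outwardForm e x) continuous_const
  have hne (x : τ.side c e) : (K x).Nonempty := by
    obtain ⟨v, hv, hv₀⟩ := S.exists_norm_eq_one_outwardForm_eq_zero e (τ.side_subset c e x.2)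
    exact ⟨v, mem_sphere_zero_iff_norm.2 hv, hv₀.le⟩
  have hanti {x y : τ.side c e} (hxy : (x : ℝ) ∈ uIcc c (y : ℝ)) : K y ⊆ K x :=
    fun v hv => ⟨hv.1, (S.outwardForm_le v x.2 y.2 hxy).trans hv.2⟩
  have hdir : Directed (· ⊇ ·) K := fun x y =>
    (mem_uIcc_or_mem_uIcc x.2 y.2).elim (fun h => ⟨y, hanti h, subset_rfl⟩)
      fun h => ⟨x, subset_rfl, hanti h⟩
  have hc := mem_side S.mem e
  have : Nonempty (τ.side c e) := ⟨⟨c, hc⟩⟩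
  obtain ⟨v, hv⟩ := IsCompact.nonempty_iInter_of_directed_nonempty_isCompact_isClosed K hdir hne
    (fun x => (isCompact_sphere 0 1).inter_right (hhalf x))
    (fun x => Metric.isClosed_sphere.inter (hhalf x))
  rw [mem_iInter] at hv
  exact ⟨v, Metric.ne_of_mem_sphere (hv ⟨c, hc⟩).1 one_ne_zero, fun x hx => (hv ⟨x, hx⟩).2⟩

lemma mem_l2Space_of_outwardForm_nonpos (hz : z.im ≠ 0)
    (h : ∀ x ∈ τ.side c e, S.outwardForm e v x ≤ 0) : v ∈ S.l2Space (τ.side c e) := by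
  have hsub := τ.side_subset c e
  have hJ := τ.ordConnected_side c e
  have hc := mem_side S.mem e
  have h₀ := ae_restrict_of_ae_restrict_of_subset hsub (τ.ae_r_mul_norm_sq_nonneg (S.solution v))
  rw [mem_l2Space, memLp_two_iff_of_continuousOn (S.continuousOn_solution v) hJ.measurableSet hsub]
  refine integrableOn_of_abs_intervalIntegral_le (M := -S.outwardForm e v c / z.im ^ 2) hJ
    ((locallyIntegrableOn_r_mul_norm_sq (S.continuousOn_solution v)).mono_set hsub) h₀ hc
    fun x hx => ?_
  rw [abs_intervalIntegral_eq_setIntegral hJ h₀ hc hx, le_div_iff₀ (by positivity)]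
  linarith [S.outwardForm_sub v hx, h x hx]

lemma exists_ne_zero_mem_l2Space (hz : z.im ≠ 0) (e : Endpoint) :
    ∃ w ∈ S.l2Space (τ.side c e), w ≠ 0 ∧ ∀ x ∈ τ.side c e, S.outwardForm e w x ≤ 0 := by
  obtain ⟨w, hw₀, hw⟩ := S.exists_outwardForm_nonpos e
  exact ⟨w, S.mem_l2Space_of_outwardForm_nonpos hz hw, hw₀, hw⟩

lemma finrank_l2Space_eq_one (hz : z.im ≠ 0) (he : ¬ τ.LimitCircle e) :
    Module.finrank ℂ (S.l2Space (τ.side c e)) = 1 := by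
  rw [S.limitCircle_iff] at he
  have hlt := Submodule.finrank_lt he
  simp only [Module.finrank_prod, Module.finrank_self] at hlt
  obtain ⟨w, hw, hw₀, -⟩ := S.exists_ne_zero_mem_l2Space hz e
  have hpos : 0 < Module.finrank ℂ (S.l2Space (τ.side c e)) :=
    Module.finrank_pos_iff_exists_ne_zero.2 ⟨⟨w, hw⟩, fun h => hw₀ (congrArg Subtype.val h)⟩
  omega

lemma outwardForm_nonpos (hz : z.im ≠ 0) (he : ¬ τ.LimitCircle e)
    (hv : v ∈ S.l2Space (τ.side c e)) (hx : x ∈ τ.side c e) : S.outwardForm e v x ≤ 0 := by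
  obtain ⟨w, hwm, hw₀, hw⟩ := S.exists_ne_zero_mem_l2Space hz e
  obtain ⟨t, ht⟩ := exists_smul_eq_of_finrank_eq_one (S.finrank_l2Space_eq_one hz he)
    (x := ⟨w, hwm⟩) (fun h => hw₀ (congrArg Subtype.val h)) ⟨v, hv⟩
  have htv : t • w = v := congrArg Subtype.val ht
  rw [← htv, outwardForm_smul]
  exact mul_nonpos_of_nonneg_of_nonpos (by positivity) (hw x hx)

lemma eq_zero_of_setIntegral_Ioc_eq_zero (hx : x ∈ τ.I) (hy : y ∈ τ.I) (hxy : x < y)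
    (h : ∫ t in Ioc x y, τ.r t * ‖S.solution v t‖ ^ 2 = 0) : v = 0 := by
  have hsub : Ioc x y ⊆ τ.I := Ioc_subset_Icc_self.trans (τ.ordConnected_I.out hx hy)
  have hint := ((locallyIntegrableOn_r_mul_norm_sq
    (S.continuousOn_solution v)).integrableOn_compact_subset (τ.ordConnected_I.out hx hy)
      isCompact_Icc).mono_set Ioc_subset_Icc_self
  rw [setIntegral_eq_zero_iff_of_nonneg_ae (ae_restrict_of_ae_restrict_of_subset hsub
    (τ.ae_r_mul_norm_sq_nonneg _)) hint] at h
  refine S.eq_zero_of_ae_eq_zero isOpen_Ioo (Ioo_subset_Ioc_self.trans hsub) (nonempty_Ioo.2 hxy) ?_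
  filter_upwards [ae_restrict_of_ae_restrict_of_subset Ioo_subset_Ioc_self h,
    ae_restrict_of_ae_restrict_of_subset (Ioo_subset_Ioc_self.trans hsub) τ.ae_r_pos] with t ht hr
  simpa [hr.ne'] using ht

lemma l2Space_inf_eq_bot (hz : z.im ≠ 0) (h : ∀ e, ¬ τ.LimitCircle e) :
    S.l2Space (τ.side c .a) ⊓ S.l2Space (τ.side c .b) = ⊥ := by
  rw [eq_bot_iff]
  rintro v ⟨hva, hvb⟩
  obtain ⟨d, hd, hcd⟩ := ((eventually_nhdsWithin_of_eventually_nhds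
    (τ.isOpen_I.eventually_mem S.mem)).and self_mem_nhdsWithin : ∀ᶠ d in 𝓝[>] c, _).exists
  have hdb : d ∈ τ.side c .b := ⟨hd, Ioi_subset_Ici_self hcd⟩
  have ha := S.outwardForm_nonpos hz (h .a) hva (mem_side S.mem .a)
  have hb := S.outwardForm_nonpos hz (h .b) hvb hdb
  have hsub := S.outwardForm_sub v hdb
  have hneg : S.outwardForm .a v c = -S.outwardForm .b v c := by
    simp [outwardForm, Endpoint.sign]
  rw [uIoc_of_le hdb.2] at hsub
  have hle : ∫ t in Ioc c d, τ.r t * ‖S.solution v t‖ ^ 2 ≤ 0 :=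
    nonpos_of_mul_nonpos_right (by linarith) (by positivity : 0 < z.im ^ 2)
  have hge := setIntegral_nonneg_of_ae_restrict (ae_restrict_of_ae_restrict_of_subset
    (Ioc_subset_Icc_self.trans (τ.ordConnected_I.out S.mem hd))
    (τ.ae_r_mul_norm_sq_nonneg (S.solution v)))
  exact (Submodule.mem_bot ℂ).2
    (S.eq_zero_of_setIntegral_Ioc_eq_zero S.mem hd hcd (hle.antisymm hge))

end FundamentalSystem

end SturmLiouville

/-! ### The adjoint of `T₀` -/

lemma intervalIntegral_eq_zero_of_notMem_Ioc {E : Type*} [NormedAddCommGroup E] [NormedSpace ℝ E]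
    {G : ℝ → E} {α β x : ℝ} (hx : x ∉ Ioc α β) (hG : ∀ᵐ t, t ∈ uIoc α x → t ∉ Ioc α β → G t = 0)
    (h : ∫ t in Ioc α β, G t = 0) : ∫ t in α..x, G t = 0 := by
  rcases le_or_gt x α with hxα | hαx
  · refine intervalIntegral.integral_zero_ae ?_
    filter_upwards [hG] with t ht htx
    exact ht htx fun htJ => htJ.1.not_ge (uIoc_of_ge hxα ▸ htx).2
  · have hβx : β < x := not_le.1 fun hxβ => hx ⟨hαx, hxβ⟩
    rw [intervalIntegral.integral_of_le hαx.le, ← h]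
    refine setIntegral_eq_of_subset_of_ae_sdiff_eq_zero measurableSet_Ioc.nullMeasurableSet
      (Ioc_subset_Ioc_right hβx.le) ?_
    filter_upwards [hG] with t ht htx
    exact ht (uIoc_of_le hαx.le ▸ htx.1) htx.2

namespace SturmLiouville

variable {τ : SturmLiouville}

lemma exists_Ioo_of_isCompact {K : Set ℝ} (hK : IsCompact K) (hKI : K ⊆ τ.I) :
    ∃ α ∈ τ.I, ∃ β ∈ τ.I, α < β ∧ K ⊆ Ioo α β := by
  obtain ⟨c, hc⟩ := τ.nonempty_I
  have hKI' : insert c K ⊆ τ.I := insert_subset hc hKI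
  obtain ⟨l, hl, hlmin⟩ := (hK.insert c).exists_isLeast (insert_nonempty c K)
  obtain ⟨u, hu, humax⟩ := (hK.insert c).exists_isGreatest (insert_nonempty c K)
  obtain ⟨α, hαl, hα⟩ := (τ.isOpen_I.eventually_mem (hKI' hl)).exists_lt
  obtain ⟨β, huβ, hβ⟩ := (τ.isOpen_I.eventually_mem (hKI' hu)).exists_gt
  exact ⟨α, hα, β, hβ, hαl.trans ((hlmin hu).trans_lt huβ), fun x hx =>
    ⟨hαl.trans_le (hlmin (mem_insert_of_mem c hx)),
      (humax (mem_insert_of_mem c hx)).trans_lt huβ⟩⟩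

lemma Ioc_subset_I {α β : ℝ} (hα : α ∈ τ.I) (hβ : β ∈ τ.I) : Ioc α β ⊆ τ.I :=
  Ioc_subset_Icc_self.trans (τ.ordConnected_I.out hα hβ)

lemma inner_eq_integral (F G : τ.H) : inner ℂ F G = ∫ x, star (F x) * G x ∂τ.μ := by
  simp only [L2.inner_def, RCLike.inner_apply', starRingEnd_apply]

lemma integrable_star_mul (F G : τ.H) : Integrable (fun x => star (F x) * G x) τ.μ := by
  simpa only [RCLike.inner_apply', starRingEnd_apply] using L2.integrable_inner (𝕜 := ℂ) F G

lemma expr_eq_zero_of_eqOn {f f₁ : ℝ → ℂ} {U : Set ℝ} (hU : IsOpen U) (h : EqOn f 0 U)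
    (h₁ : EqOn f₁ 0 U) {x : ℝ} (hx : x ∈ U) : τ.expr f f₁ x = 0 := by
  rw [expr, (h₁.eventuallyEq_of_mem (hU.mem_nhds hx)).deriv_eq, h hx, h₁ hx]
  simp

lemma IsQuasiDeriv.integral_lagrange_eq_zero {f f₁ g g₁ : ℝ → ℂ} (hf : τ.IsQuasiDeriv f f₁)
    (hg : τ.IsQuasiDeriv g g₁) {K : Set ℝ} (hK : IsCompact K) (hKI : K ⊆ τ.I)
    (h₀ : ∀ᵐ x ∂τ.μ, x ∉ K → f x = 0) :
    ∫ x, τ.expr f f₁ x * g x - f x * τ.expr g g₁ x ∂τ.μ = 0 := by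
  have hU : IsOpen (τ.I \ K) := τ.isOpen_I.sdiff hK.isClosed
  obtain ⟨hf₀, hf₁₀⟩ := hf.eqOn_zero hU sdiff_subset (by
    filter_upwards [ae_restrict_of_ae_restrict_of_subset sdiff_subset (τ.ae_μ_iff.1 h₀),
      ae_restrict_mem hU.measurableSet] with x hx hxU using hx hxU.2)
  obtain ⟨α, hα, β, hβ, hαβ, hKαβ⟩ := exists_Ioo_of_isCompact hK hKI
  have hαU : α ∈ τ.I \ K := ⟨hα, fun h => left_notMem_Ioo (hKαβ h)⟩
  have hβU : β ∈ τ.I \ K := ⟨hβ, fun h => right_notMem_Ioo (hKαβ h)⟩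
  rw [integral_μ, setIntegral_eq_of_subset_of_forall_sdiff_eq_zero τ.measurableSet_I
    (Ioc_subset_I hα hβ), ← intervalIntegral.integral_of_le hαβ.le, hf.integral_lagrange hg hα hβ]
  · simp [wronskian, hf₀ hαU, hf₀ hβU, hf₁₀ hαU, hf₁₀ hβU]
  · intro x hx
    have hxU : x ∈ τ.I \ K := ⟨hx.1, fun h => hx.2 (Ioo_subset_Ioc_self (hKαβ h))⟩
    simp [expr_eq_zero_of_eqOn hU hf₀ hf₁₀ hxU, hf₀ hxU]

lemma mem_T0_graph {F : τ.H × τ.H} :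
    F ∈ τ.T0.graph ↔ F ∈ τ.maxGraph ∧ F.1 ∈ τ.compactlySupported := by
  rw [← τ.Tmax_graph, T0, LinearPMap.mem_graph_iff, LinearPMap.mem_graph_iff]
  constructor
  · rintro ⟨y, hyF, hy⟩
    have hmem : (y : τ.H) ∈ τ.compactlySupported ⊓ τ.Tmax.domain := y.2
    exact ⟨⟨⟨y, hmem.2⟩, hyF, (LinearPMap.domRestrict_apply rfl).symm.trans hy⟩, hyF ▸ hmem.1⟩
  · rintro ⟨⟨y, hyF, hy⟩, hF⟩
    exact ⟨⟨y, hyF ▸ hF, y.2⟩, hyF, (LinearPMap.domRestrict_apply rfl).trans hy⟩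

lemma inner_eq_inner_of_mem_T0_graph {F g k W : τ.H} {w w₁ : ℝ → ℂ} (hFg : (F, g) ∈ τ.T0.graph)
    (hw : τ.IsQuasiDeriv w w₁) (hwk : k =ᵐ[τ.μ] τ.expr w w₁)
    (hW : ∀ᵐ x ∂τ.μ, g x ≠ 0 → W x = w x) : inner ℂ g W = inner ℂ F k := by
  obtain ⟨⟨f, f₁, hf, hfF, hfg⟩, K, hK, hKI, hK₀⟩ := mem_T0_graph.1 hFg
  have hstar : ∀ᵐ x ∂τ.μ, x ∉ K → star (f x) = 0 := by
    filter_upwards [hfF, hK₀] with x hx hx₀ hxK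
    rw [← hx, hx₀ hxK, star_zero]
  rw [← sub_eq_zero, inner_eq_integral, inner_eq_integral,
    ← integral_sub (integrable_star_mul g W) (integrable_star_mul F k),
    ← hf.star.integral_lagrange_eq_zero hw hK hKI hstar]
  refine integral_congr_ae ?_
  filter_upwards [hfF, hfg, hwk, hW] with x hFx hgx hkx hWx
  rw [expr_star, ← hgx, ← hFx, ← hkx]
  by_cases hg₀ : g x = 0
  · simp [hg₀]
  · rw [hWx hg₀]

lemma maxGraph_le_adjoint (τ : SturmLiouville) : τ.maxGraph ≤ τ.T0.graph.adjoint := by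
  rintro ⟨h, k⟩ ⟨w, w₁, hw, hwh, hwk⟩
  refine (Submodule.mem_adjoint_iff _ _).2 fun F g hFg => sub_eq_zero.2 ?_
  refine inner_eq_inner_of_mem_T0_graph hFg hw hwk ?_
  filter_upwards [hwh] with x hx _ using hx

lemma inner_eq_zero_of_mem_adjoint {F g h k D : τ.H} {w w₁ : ℝ → ℂ} {J : Set ℝ}
    (hhk : (h, k) ∈ τ.T0.graph.adjoint) (hFg : (F, g) ∈ τ.T0.graph) (hw : τ.IsQuasiDeriv w w₁)
    (hwk : k =ᵐ[τ.μ] τ.expr w w₁) (hg : ∀ᵐ x ∂τ.μ, x ∉ J → g x = 0)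
    (hD : D =ᵐ[τ.μ] J.indicator (⇑h - w)) : inner ℂ g D = 0 := by
  have hgk : inner ℂ g (h - D) = inner ℂ F k := by
    refine inner_eq_inner_of_mem_T0_graph hFg hw hwk ?_
    filter_upwards [hD, hg, Lp.coeFn_sub h D] with x hx hgx hsub hne
    have hxJ : x ∈ J := by_contra fun hxJ => hne (hgx hxJ)
    rw [hsub, Pi.sub_apply, hx, indicator_of_mem hxJ, Pi.sub_apply, sub_sub_cancel]
  have hadj := (Submodule.mem_adjoint_iff _ _).1 hhk F g hFg
  rw [inner_sub_right] at hgk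
  linear_combination hadj - hgk

lemma memLp_indicator_Ioc {w : ℝ → ℂ} (hw : ContinuousOn w τ.I) {α β : ℝ} (hα : α ∈ τ.I)
    (hβ : β ∈ τ.I) : MemLp ((Ioc α β).indicator w) 2 τ.μ := by
  rw [memLp_indicator_iff_restrict measurableSet_Ioc]
  exact (memLp_restrict_of_isCompact hw isCompact_Icc (τ.ordConnected_I.out hα hβ)).mono_measure
    (Measure.restrict_mono Ioc_subset_Icc_self le_rfl)

namespace FundamentalSystem

section

variable {z : ℂ} {c : ℝ} (S : τ.FundamentalSystem z c) {α β : ℝ}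

/-- The map sending initial values at `c` to the solution, cut off outside `(α, β]`. -/
noncomputable def truncation (hα : α ∈ τ.I) (hβ : β ∈ τ.I) : ℂ × ℂ →ₗ[ℂ] τ.H where
  toFun v := (memLp_indicator_Ioc (S.continuousOn_solution v) hα hβ).toLp _
  map_add' v w := by
    rw [← MemLp.toLp_add]
    exact MemLp.toLp_congr _ _ (by rw [map_add, indicator_add'])
  map_smul' t v := by
    rw [RingHom.id_apply, ← MemLp.toLp_const_smul]
    refine MemLp.toLp_congr _ _ ?_
    rw [map_smul]
    exact .of_eq (indicator_const_smul _ t (S.solution v))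

lemma coeFn_truncation (hα : α ∈ τ.I) (hβ : β ∈ τ.I) (v : ℂ × ℂ) :
    S.truncation hα hβ v =ᵐ[τ.μ] (Ioc α β).indicator (S.solution v) :=
  (memLp_indicator_Ioc (S.continuousOn_solution v) hα hβ).coeFn_toLp

lemma inner_truncation (hα : α ∈ τ.I) (hβ : β ∈ τ.I) (v : ℂ × ℂ) (g : τ.H) :
    inner ℂ (S.truncation hα hβ v) g =
      ∫ x in Ioc α β, (τ.r x : ℂ) * (g x * star (S.solution v x)) := by
  rw [inner_eq_integral, ← inter_eq_right.2 (Ioc_subset_I hα hβ),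
    ← setIntegral_indicator measurableSet_Ioc, integral_μ]
  refine integral_congr_ae ?_
  filter_upwards [τ.ae_μ_iff.1 (S.coeFn_truncation hα hβ v)] with x hx
  rw [hx]
  by_cases hxJ : x ∈ Ioc α β <;> simp [hxJ, mul_comm]

lemma eq_of_ae_eq_solution {f : ℝ → ℂ} {U : Set ℝ} {v v' : ℂ × ℂ} (hU : IsOpen U) (hUI : U ⊆ τ.I)
    (hne : U.Nonempty) (hv : ∀ᵐ x ∂volume.restrict U, f x = S.solution v x)
    (hv' : ∀ᵐ x ∂volume.restrict U, f x = S.solution v' x) : v = v' := by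
  refine sub_eq_zero.1 (S.eq_zero_of_ae_eq_zero hU hUI hne ?_)
  filter_upwards [hv, hv'] with x hx hx'
  rw [map_sub, Pi.sub_apply, ← hx, ← hx', sub_self]

lemma exists_ae_eq_solution {f : ℝ → ℂ} (h : ∀ α ∈ τ.I, ∀ β ∈ τ.I, ∃ v,
      ∀ᵐ x ∂volume.restrict (Ioc α β), f x = S.solution v x) :
    ∃ v, ∀ᵐ x ∂volume.restrict τ.I, f x = S.solution v x := by
  obtain ⟨α₀, hα₀, β₀, hβ₀, hαβ₀, -⟩ := exists_Ioo_of_isCompact (isCompact_singleton (x := c))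
    (singleton_subset_iff.2 S.mem)
  obtain ⟨v, hv⟩ := h α₀ hα₀ β₀ hβ₀
  refine ⟨v, ?_⟩
  rw [ae_iff, Measure.restrict_apply₀' τ.measurableSet_I.nullMeasurableSet]
  refine measure_null_of_locally_null _ fun x hx => ?_
  obtain ⟨α, hα, β, hβ, -, hsub⟩ := exists_Ioo_of_isCompact (K := {x, α₀, β₀})
    (toFinite _).isCompact (insert_subset hx.2 (pair_subset hα₀ hβ₀))
  simp only [insert_subset_iff, singleton_subset_iff] at hsub
  obtain ⟨hxm, hα₀m, hβ₀m⟩ := hsub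
  obtain ⟨v', hv'⟩ := h α hα β hβ
  have hvv' : v = v' := S.eq_of_ae_eq_solution isOpen_Ioo
    (Ioo_subset_Ioc_self.trans (Ioc_subset_I hα₀ hβ₀)) (nonempty_Ioo.2 hαβ₀)
    (ae_restrict_of_ae_restrict_of_subset Ioo_subset_Ioc_self hv)
    (ae_restrict_of_ae_restrict_of_subset
      ((Ioo_subset_Ioo hα₀m.1.le hβ₀m.2.le).trans Ioo_subset_Ioc_self) hv')
  rw [← hvv', ae_iff, Measure.restrict_apply₀' measurableSet_Ioc.nullMeasurableSet] at hv'
  refine ⟨_ ∩ Ioo α β, inter_mem_nhdsWithin _ (isOpen_Ioo.mem_nhds hxm), measure_mono_null ?_ hv'⟩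
  exact fun y hy => ⟨hy.1.1, Ioo_subset_Ioc_self hy.2⟩

end

variable {c : ℝ} (S : τ.FundamentalSystem 0 c) {α β : ℝ}

include S in
lemma eq_zero_of_notMem_Ioc (hα : α ∈ τ.I) {f f₁ g : ℝ → ℂ} (hf : τ.IsQuasiDeriv f f₁)
    (hfg : ∀ᵐ x ∂volume.restrict τ.I, τ.expr f f₁ x = g x) (hfα : f α = 0) (hf₁α : f₁ α = 0)
    (hg : ∀ᵐ x ∂volume.restrict τ.I, x ∉ Ioc α β → g x = 0)
    (horth : ∀ u u₁, τ.IsSolPair 0 u u₁ → ∫ x in Ioc α β, (τ.r x : ℂ) * (g x * u x) = 0) {x : ℝ}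
    (hx : x ∈ τ.I) (hxJ : x ∉ Ioc α β) : f x = 0 := by
  have hW {u u₁ : ℝ → ℂ} (hu : τ.IsSolPair 0 u u₁) : wronskian f f₁ u u₁ x = 0 := by
    have hsub := hu.wronskian_sub hf (by simpa using hfg) hα hx
    rw [intervalIntegral_eq_zero_of_notMem_Ioc hxJ ?_ (horth u u₁ hu), sub_eq_zero] at hsub
    · rw [hsub]
      simp [wronskian, hfα, hf₁α]
    · filter_upwards [ae_mem_uIoc_of_ae_restrict hg hα hx] with t ht htx htJ
      simp [ht htx htJ]
  simp [S.eq_wronskian_mul_sub f f₁ hx, hW S.sol_θ, hW S.sol_φ]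

include S in
lemma exists_mem_T0_graph (hα : α ∈ τ.I) (hβ : β ∈ τ.I) {g : τ.H}
    (hg : ∀ᵐ x ∂τ.μ, x ∉ Ioc α β → g x = 0)
    (horth : ∀ u u₁, τ.IsSolPair 0 u u₁ → ∫ x in Ioc α β, (τ.r x : ℂ) * (g x * u x) = 0) :
    ∃ F : τ.H, (F, g) ∈ τ.T0.graph := by
  obtain ⟨f, f₁, hf, hfg, hfα, hf₁α⟩ := exists_initial_value 0
    (locallyIntegrableOn_r_mul (Lp.memLp g)) hα 0 0
  replace hfg : ∀ᵐ x ∂volume.restrict τ.I, τ.expr f f₁ x = g x := by simpa using hfg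
  have hf₀ {x : ℝ} (hx : x ∈ τ.I) (hxJ : x ∉ Ioc α β) : f x = 0 :=
    S.eq_zero_of_notMem_Ioc hα hf hfg hfα hf₁α (τ.ae_μ_iff.1 hg) horth hx hxJ
  have hL := memLp_indicator_Ioc hf.ac.continuousOn hα hβ
  have hind : ∀ᵐ x ∂τ.μ, (Ioc α β).indicator f x = f x := by
    refine τ.ae_μ_iff.2 ?_
    filter_upwards [ae_restrict_mem τ.measurableSet_I] with x hx
    exact indicator_apply_eq_self.2 (hf₀ hx)
  refine ⟨hL.toLp _, mem_T0_graph.2 ⟨⟨f, f₁, hf, hL.coeFn_toLp.trans hind, ?_⟩,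
    Icc α β, isCompact_Icc, τ.ordConnected_I.out hα hβ, ?_⟩⟩
  · filter_upwards [τ.ae_μ_iff.2 hfg] with x hx using hx.symm
  · filter_upwards [hL.coeFn_toLp] with x hx hxK
    rw [hx, indicator_of_notMem fun h => hxK (Ioc_subset_Icc_self h)]

lemma integral_r_mul_eq_zero_of_mem_orthogonal (hα : α ∈ τ.I) (hβ : β ∈ τ.I) {g : τ.H}
    (hg : g ∈ (LinearMap.range (S.truncation hα hβ))ᗮ) {u u₁ : ℝ → ℂ} (hu : τ.IsSolPair 0 u u₁) :
    ∫ x in Ioc α β, (τ.r x : ℂ) * (g x * u x) = 0 := by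
  have hstar : τ.IsSolPair 0 (fun x => star (u x)) fun x => star (u₁ x) := by
    simpa using hu.star
  rw [← (Submodule.mem_orthogonal _ _).1 hg _
    (LinearMap.mem_range_self _ (star (u c), star (u₁ c))), S.inner_truncation hα hβ]
  refine setIntegral_congr_fun measurableSet_Ioc fun x hx => ?_
  simp only [← S.eq_solution hstar (Ioc_subset_I hα hβ hx), star_star]

lemma exists_ae_sub_eq_solution (hα : α ∈ τ.I) (hβ : β ∈ τ.I) {h k : τ.H}
    (hhk : (h, k) ∈ τ.T0.graph.adjoint) {w w₁ : ℝ → ℂ} (hw : τ.IsQuasiDeriv w w₁)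
    (hwk : k =ᵐ[τ.μ] τ.expr w w₁) :
    ∃ v, ∀ᵐ x ∂volume.restrict (Ioc α β), h x - w x = S.solution v x := by
  -- Let `g` be the part of `D = (h - w) 1_(α, β]` orthogonal to the truncated solutions. It is in
  -- the range of `T₀`, and `⟪T₀ F, h⟫ = ⟪F, k⟫ = ⟪T₀ F, w⟫`; hence `⟪g, D⟫ = 0` and `g = 0`.
  have hDL : MemLp ((Ioc α β).indicator (⇑h - w)) 2 τ.μ := by
    rw [indicator_sub']
    exact ((Lp.memLp h).indicator measurableSet_Ioc).sub
      (memLp_indicator_Ioc hw.ac.continuousOn hα hβ)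
  have hD := hDL.coeFn_toLp
  set D : τ.H := hDL.toLp _
  obtain ⟨y, ⟨v, rfl⟩, g, hg, hDg⟩ :=
    (LinearMap.range (S.truncation hα hβ)).exists_add_mem_mem_orthogonal D
  have hv := S.coeFn_truncation hα hβ v
  have hg₀ : ∀ᵐ x ∂τ.μ, x ∉ Ioc α β → g x = 0 := by
    rw [← sub_eq_iff_eq_add'.2 hDg]
    filter_upwards [hD, hv, Lp.coeFn_sub D (S.truncation hα hβ v)] with x hx hvx hsub hxJ
    rw [hsub, Pi.sub_apply, hx, hvx, indicator_of_notMem hxJ, indicator_of_notMem hxJ, sub_zero]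
  obtain ⟨F, hF⟩ := S.exists_mem_T0_graph hα hβ hg₀ fun u u₁ hu =>
    S.integral_r_mul_eq_zero_of_mem_orthogonal hα hβ hg hu
  have hgD := inner_eq_zero_of_mem_adjoint hhk hF hw hwk hg₀ hD
  have hg_zero : g = 0 := by
    rw [hDg, inner_add_right,
      Submodule.inner_left_of_mem_orthogonal (LinearMap.mem_range_self _ v) hg, zero_add] at hgD
    exact inner_self_eq_zero.1 hgD
  rw [hg_zero, add_zero] at hDg
  rw [hDg] at hD
  refine ⟨v, ?_⟩
  filter_upwards [ae_restrict_of_ae_restrict_of_subset (Ioc_subset_I hα hβ) (τ.ae_μ_iff.1 hD),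
    ae_restrict_of_ae_restrict_of_subset (Ioc_subset_I hα hβ) (τ.ae_μ_iff.1 hv),
    ae_restrict_mem measurableSet_Ioc] with x hx hvx hxJ
  simpa [hxJ] using hx.symm.trans hvx

end FundamentalSystem

lemma adjoint_le_maxGraph (τ : SturmLiouville) : τ.T0.graph.adjoint ≤ τ.maxGraph := by
  rintro ⟨h, k⟩ hhk
  obtain ⟨c, hc⟩ := τ.nonempty_I
  obtain ⟨S⟩ := nonempty_fundamentalSystem (τ := τ) 0 hc
  obtain ⟨w, w₁, hw, hwk, -, -⟩ := exists_initial_value 0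
    (locallyIntegrableOn_r_mul (Lp.memLp k)) hc 0 0
  replace hwk : ∀ᵐ x ∂volume.restrict τ.I, τ.expr w w₁ x = k x := by simpa using hwk
  obtain ⟨v, hv⟩ := S.exists_ae_eq_solution fun α hα β hβ => S.exists_ae_sub_eq_solution hα hβ hhk
    hw ((τ.ae_μ_iff.2 hwk).mono fun _ => Eq.symm)
  have hu := S.isSolPair_solution v
  refine ⟨w + S.solution v, w₁ + S.solution₁ v, hw.add hu.qd, τ.ae_μ_iff.2 ?_, τ.ae_μ_iff.2 ?_⟩
  · filter_upwards [hv] with x hx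
    rw [Pi.add_apply, ← hx, add_sub_cancel]
  · filter_upwards [hw.expr_add hu.qd, hwk, hu.eq] with x hadd hwx hux
    rw [hadd, hwx, hux, zero_mul, add_zero]

lemma T0_graph_adjoint (τ : SturmLiouville) : τ.T0.graph.adjoint = τ.maxGraph :=
  le_antisymm τ.adjoint_le_maxGraph τ.maxGraph_le_adjoint

end SturmLiouville

/-! ### Defect spaces of symmetric operators -/

section DefectSpaces

variable {𝕜 E : Type*} [RCLike 𝕜] [NormedAddCommGroup E] [InnerProductSpace 𝕜 E]

lemma adjoint_topologicalClosure_eq {F : Type*} [NormedAddCommGroup F] [InnerProductSpace 𝕜 F]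
    (g : Submodule 𝕜 (E × F)) : g.topologicalClosure.adjoint = g.adjoint := by
  ext x
  rw [Submodule.mem_adjoint_iff, Submodule.mem_adjoint_iff]
  refine ⟨fun h a b hab => h a b (g.le_topologicalClosure hab), fun h a b hab => ?_⟩
  have hclosed : IsClosed {y : E × F | inner 𝕜 y.2 x.1 - inner 𝕜 y.1 x.2 = 0} :=
    isClosed_eq (by fun_prop) continuous_const
  exact closure_minimal (fun y hy => h y.1 y.2 hy) hclosed hab

lemma mem_range_sub_smul_iff {T : E →ₗ.[𝕜] E} {z : 𝕜} {y : E} :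
    y ∈ LinearMap.range (T.toFun - z • T.domain.subtype) ↔ ∃ x ∈ T.graph, x.2 - z • x.1 = y := by
  constructor
  · rintro ⟨x, rfl⟩
    exact ⟨_, T.mem_graph x, rfl⟩
  · rintro ⟨⟨x, Tx⟩, hx, rfl⟩
    obtain ⟨x, rfl, rfl⟩ := T.mem_graph_iff.1 hx
    exact ⟨x, rfl⟩

lemma mem_orthogonal_range_sub_smul_iff {T : E →ₗ.[𝕜] E} {z : 𝕜} {h : E} :
    h ∈ (LinearMap.range (T.toFun - z • T.domain.subtype))ᗮ ↔
      (h, star z • h) ∈ T.graph.adjoint := by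
  simp only [Submodule.mem_orthogonal, mem_range_sub_smul_iff, Submodule.mem_adjoint_iff,
    forall_exists_index, and_imp, Prod.forall]
  have key (a b : E) :
      inner 𝕜 (b - z • a) h = 0 ↔ inner 𝕜 b h - inner 𝕜 a (star z • h) = 0 := by
    rw [inner_sub_left, inner_smul_left, inner_smul_right, starRingEnd_apply]
  exact ⟨fun H a b hab => (key a b).1 (H _ a b hab rfl),
    fun H _ a b hab hy => hy ▸ (key a b).2 (H a b hab)⟩

lemma graph_le_adjoint_graph_of_isFormalAdjoint {T : E →ₗ.[𝕜] E} (hT : T.IsFormalAdjoint T) :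
    T.graph ≤ T.graph.adjoint := by
  rintro ⟨x, Tx⟩ hx
  refine (Submodule.mem_adjoint_iff _ _).2 fun y Ty hy => ?_
  obtain ⟨x, rfl, rfl⟩ := T.mem_graph_iff.1 hx
  obtain ⟨y, rfl, rfl⟩ := T.mem_graph_iff.1 hy
  exact sub_eq_zero.2 (hT y x)

end DefectSpaces

section SymmetricOperator

variable {E : Type*} [NormedAddCommGroup E] [InnerProductSpace ℂ E] {T : E →ₗ.[ℂ] E}

lemma norm_sub_I_smul_sq_of_isFormalAdjoint (hT : T.IsFormalAdjoint T) {x : E × E}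
    (hx : x ∈ T.graph) : ‖x.2 - Complex.I • x.1‖ ^ 2 = ‖x.2‖ ^ 2 + ‖x.1‖ ^ 2 := by
  have hsymm : inner ℂ x.2 x.1 = inner ℂ x.1 x.2 := sub_eq_zero.1 <|
    (Submodule.mem_adjoint_iff _ _).1 (graph_le_adjoint_graph_of_isFormalAdjoint hT hx) _ _ hx
  have him : (inner ℂ x.2 x.1).im = 0 := by
    rw [← Complex.conj_eq_iff_im, inner_conj_symm, hsymm]
  have hre : RCLike.re (inner ℂ x.2 (Complex.I • x.1)) = 0 := by simp [him]
  rw [norm_sub_sq (𝕜 := ℂ), hre, norm_smul, Complex.norm_I]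
  ring

lemma norm_le_norm_sub_I_smul_of_isFormalAdjoint (hT : T.IsFormalAdjoint T) {x : E × E}
    (hx : x ∈ T.graph) : ‖x‖ ≤ ‖x.2 - Complex.I • x.1‖ := by
  have hsq := norm_sub_I_smul_sq_of_isFormalAdjoint hT hx
  exact max_le (le_of_sq_le_sq (by nlinarith [sq_nonneg ‖x.2‖]) (norm_nonneg _))
    (le_of_sq_le_sq (by nlinarith [sq_nonneg ‖x.1‖]) (norm_nonneg _))

lemma isClosed_range_sub_I_smul_of_isFormalAdjoint [CompleteSpace E] (hT : T.IsFormalAdjoint T)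
    (hclosed : T.IsClosed) :
    IsClosed (LinearMap.range (T.toFun - Complex.I • T.domain.subtype) : Set E) := by
  have : CompleteSpace T.graph := hclosed.completeSpace_coe
  let L : T.graph →L[ℂ] E :=
    (ContinuousLinearMap.snd ℂ E E - Complex.I • ContinuousLinearMap.fst ℂ E E).comp
      T.graph.subtypeL
  have hL : AntilipschitzWith 1 L := AddMonoidHomClass.antilipschitz_of_bound L fun x => by
    simpa [L] using norm_le_norm_sub_I_smul_of_isFormalAdjoint hT x.2
  convert hL.isClosed_range L.uniformContinuous
  ext y
  rw [SetLike.mem_coe, mem_range_sub_smul_iff]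
  simp [L]

lemma adjoint_graph_le_of_isFormalAdjoint [CompleteSpace E] (hT : T.IsFormalAdjoint T)
    (hclosed : T.IsClosed)
    (h₁ : (LinearMap.range (T.toFun - Complex.I • T.domain.subtype))ᗮ = ⊥)
    (h₂ : (LinearMap.range (T.toFun - (-Complex.I) • T.domain.subtype))ᗮ = ⊥) :
    T.graph.adjoint ≤ T.graph := by
  rintro ⟨g, k⟩ hgk
  obtain ⟨x, hx, hxgk⟩ : ∃ x ∈ T.graph, x.2 - Complex.I • x.1 = k - Complex.I • g := by
    have := (isClosed_range_sub_I_smul_of_isFormalAdjoint hT hclosed).completeSpace_coe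
    rw [← mem_range_sub_smul_iff, Submodule.orthogonal_eq_bot_iff.1 h₁]
    exact Submodule.mem_top
  have hsub : k - x.2 = Complex.I • (g - x.1) := by
    rw [smul_sub, sub_eq_sub_iff_sub_eq_sub, ← hxgk]
  have hg : g - x.1 = 0 := by
    rw [← Submodule.mem_bot ℂ, ← h₂, mem_orthogonal_range_sub_smul_iff]
    simpa [← hsub] using
      T.graph.adjoint.sub_mem hgk (graph_le_adjoint_graph_of_isFormalAdjoint hT hx)
  rw [hg, smul_zero, sub_eq_zero] at hsub
  rwa [sub_eq_zero.1 hg, hsub]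

end SymmetricOperator

/-! ### The minimal operator and its deficiency indices -/

namespace SturmLiouville

lemma dense_T0_domain (τ : SturmLiouville) : Dense (τ.T0.domain : Set τ.H) := by
  rw [Submodule.dense_iff_topologicalClosure_eq_top, Submodule.topologicalClosure_eq_top_iff,
    eq_bot_iff]
  intro k hk
  have hadj : ((0 : τ.H), k) ∈ τ.T0.graph.adjoint := by
    refine (Submodule.mem_adjoint_iff _ _).2 fun x y hxy => ?_
    rw [inner_zero_right, hk x (LinearPMap.mem_domain_of_mem_graph hxy), sub_zero]
  exact τ.maxGraph_fst_eq_zero _ (τ.T0_graph_adjoint ▸ hadj) rfl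

lemma T0_adjoint (τ : SturmLiouville) : τ.T0.adjoint = τ.Tmax := by
  refine LinearPMap.eq_of_eq_graph ?_
  rw [LinearPMap.adjoint_graph_eq_graph_adjoint τ.dense_T0_domain, T0_graph_adjoint, Tmax_graph]

lemma isClosed_Tmax (τ : SturmLiouville) : τ.Tmax.IsClosed :=
  τ.T0_adjoint ▸ LinearPMap.adjoint_isClosed τ.dense_T0_domain

lemma isClosable_T0 (τ : SturmLiouville) : τ.T0.IsClosable :=
  τ.isClosed_Tmax.isClosable.leIsClosable LinearPMap.domRestrict_le

lemma dense_Tmin_domain (τ : SturmLiouville) : Dense (τ.Tmin.domain : Set τ.H) :=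
  τ.dense_T0_domain.mono τ.T0.le_closure.1

lemma Tmin_graph (τ : SturmLiouville) : τ.Tmin.graph = τ.T0.graph.topologicalClosure :=
  τ.isClosable_T0.graph_closure_eq_closure_graph.symm

lemma Tmin_graph_adjoint (τ : SturmLiouville) : τ.Tmin.graph.adjoint = τ.maxGraph := by
  rw [Tmin_graph, adjoint_topologicalClosure_eq, T0_graph_adjoint]

lemma Tmin_adjoint (τ : SturmLiouville) : τ.Tmin.adjoint = τ.Tmax := by
  refine LinearPMap.eq_of_eq_graph ?_
  rw [LinearPMap.adjoint_graph_eq_graph_adjoint τ.dense_Tmin_domain, Tmin_graph_adjoint,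
    Tmax_graph]

lemma Tmin_le_Tmax (τ : SturmLiouville) : τ.Tmin ≤ τ.Tmax := by
  refine LinearPMap.le_of_le_graph ?_
  rw [Tmin_graph]
  exact Submodule.topologicalClosure_minimal _
    (LinearPMap.le_graph_of_le LinearPMap.domRestrict_le) τ.isClosed_Tmax

lemma isFormalAdjoint_Tmin (τ : SturmLiouville) : τ.Tmin.IsFormalAdjoint τ.Tmin := by
  intro x y
  have h := LinearPMap.adjoint_isFormalAdjoint τ.dense_Tmin_domain
  rw [Tmin_adjoint] at h
  rw [τ.Tmin_le_Tmax.2 (x := x) (y := ⟨x, τ.Tmin_le_Tmax.1 x.2⟩) rfl]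
  exact h ⟨x, τ.Tmin_le_Tmax.1 x.2⟩ y

variable {τ : SturmLiouville}

lemma Endpoint.forall_iff {P : Endpoint → Prop} : (∀ e, P e) ↔ P .a ∧ P .b :=
  ⟨fun h => ⟨h .a, h .b⟩, fun h => fun | .a => h.1 | .b => h.2⟩

namespace FundamentalSystem

variable {z : ℂ} {c : ℝ} (S : τ.FundamentalSystem z c)

lemma mem_l2Space_univ {v : ℂ × ℂ} : v ∈ S.l2Space univ ↔ MemLp (S.solution v) 2 τ.μ := by
  rw [mem_l2Space, Measure.restrict_univ]

lemma l2Space_univ_eq_inf :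
    S.l2Space univ = S.l2Space (τ.side c .a) ⊓ S.l2Space (τ.side c .b) := by
  ext v
  rw [mem_l2Space_univ]
  exact ⟨fun h => ⟨h.restrict _, h.restrict _⟩, fun h =>
    memLp_of_forall_side (S.continuousOn_solution v) fun | .a => h.1 | .b => h.2⟩

/-- The map sending initial values at `c` to the corresponding solution, regarded as an element of
the Hilbert space. -/
noncomputable def toH : S.l2Space univ →ₗ[ℂ] τ.H where
  toFun v := (S.mem_l2Space_univ.1 v.2).toLp _
  map_add' v w := by
    rw [← MemLp.toLp_add]
    exact MemLp.toLp_congr _ _ (by rw [Submodule.coe_add, map_add])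
  map_smul' t v := by
    rw [RingHom.id_apply, ← MemLp.toLp_const_smul]
    exact MemLp.toLp_congr _ _ (by rw [Submodule.coe_smul, map_smul])

lemma coeFn_toH (v : S.l2Space univ) : S.toH v =ᵐ[τ.μ] S.solution v :=
  (S.mem_l2Space_univ.1 v.2).coeFn_toLp

lemma toH_injective : Function.Injective S.toH := by
  refine (injective_iff_map_eq_zero _).2 fun v hv => Subtype.ext ?_
  refine S.eq_zero_of_ae_eq_zero τ.isOpen_I subset_rfl τ.nonempty_I (τ.ae_μ_iff.1 ?_)
  filter_upwards [S.coeFn_toH v, Lp.coeFn_zero ℂ 2 τ.μ] with x hx hx₀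
  rw [← hx, hv, hx₀, Pi.zero_apply]

lemma mem_range_toH {h : τ.H} : h ∈ LinearMap.range S.toH ↔ (h, z • h) ∈ τ.maxGraph := by
  constructor
  · rintro ⟨v, rfl⟩
    have hv := S.isSolPair_solution v
    refine ⟨S.solution v, S.solution₁ v, hv.qd, S.coeFn_toH v, ?_⟩
    filter_upwards [Lp.coeFn_smul z (S.toH v), S.coeFn_toH v, τ.ae_μ_iff.2 hv.eq]
      with x hsmul hx hxv
    rw [hsmul, hxv, Pi.smul_apply, hx, smul_eq_mul]
  · rintro ⟨f, f₁, hf, hhf, hzh⟩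
    have hsol : τ.IsSolPair z f f₁ := by
      refine ⟨hf, τ.ae_μ_iff.1 ?_⟩
      filter_upwards [hhf, hzh, Lp.coeFn_smul z h] with x hx hzx hsmul
      rw [← hzx, ← hx, hsmul, Pi.smul_apply, smul_eq_mul]
    have hh : h =ᵐ[τ.μ] S.solution (f c, f₁ c) := by
      filter_upwards [hhf, τ.ae_μ_iff.2 (ae_restrict_mem τ.measurableSet_I)] with x hx hxI
      rw [hx, S.eq_solution hsol hxI]
    exact ⟨⟨_, S.mem_l2Space_univ.2 ((memLp_congr_ae hh).1 (Lp.memLp h))⟩,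
      Lp.ext ((S.coeFn_toH _).trans hh.symm)⟩

end FundamentalSystem

lemma defectNumber_Tmin (z : ℂ) {c : ℝ} (S : τ.FundamentalSystem (star z) c) :
    defectNumber τ.Tmin z = Module.finrank ℂ (S.l2Space univ) := by
  have hrange : (LinearMap.range (τ.Tmin.toFun - z • τ.Tmin.domain.subtype))ᗮ =
      LinearMap.range S.toH := by
    ext h
    rw [mem_orthogonal_range_sub_smul_iff, Tmin_graph_adjoint, S.mem_range_toH]
  rw [defectNumber, hrange, Module.finrank_eq_rank,
    (LinearEquiv.ofInjective S.toH S.toH_injective).rank_eq]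

lemma defectNumber_Tmin_eq_zero (τ : SturmLiouville) {z : ℂ} (hz : z.im ≠ 0)
    (h : ∀ e, ¬ τ.LimitCircle e) : defectNumber τ.Tmin z = 0 := by
  obtain ⟨c, hc⟩ := τ.nonempty_I
  obtain ⟨S⟩ := nonempty_fundamentalSystem (star z) hc
  rw [defectNumber_Tmin z S, S.l2Space_univ_eq_inf,
    S.l2Space_inf_eq_bot (by simpa using hz) h, finrank_bot, Nat.cast_zero]

lemma defectNumber_Tmin_eq_one (τ : SturmLiouville) {z : ℂ} (hz : z.im ≠ 0)
    (h : Xor (τ.LimitCircle .a) (τ.LimitCircle .b)) : defectNumber τ.Tmin z = 1 := by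
  obtain ⟨c, hc⟩ := τ.nonempty_I
  obtain ⟨S⟩ := nonempty_fundamentalSystem (star z) hc
  have hz' : (star z).im ≠ 0 := by simpa using hz
  rw [defectNumber_Tmin z S, S.l2Space_univ_eq_inf]
  rcases h with ⟨ha, hb⟩ | ⟨hb, ha⟩
  · rw [(S.limitCircle_iff .a).1 ha, top_inf_eq, S.finrank_l2Space_eq_one hz' hb, Nat.cast_one]
  · rw [(S.limitCircle_iff .b).1 hb, inf_top_eq, S.finrank_l2Space_eq_one hz' ha, Nat.cast_one]

lemma defectNumber_Tmin_eq_two (τ : SturmLiouville) (z : ℂ) (h : ∀ e, τ.LimitCircle e) :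
    defectNumber τ.Tmin z = 2 := by
  obtain ⟨c, hc⟩ := τ.nonempty_I
  obtain ⟨S⟩ := nonempty_fundamentalSystem (star z) hc
  rw [defectNumber_Tmin z S, S.l2Space_univ_eq_inf, (S.limitCircle_iff .a).1 (h .a),
    (S.limitCircle_iff .b).1 (h .b), inf_idem, finrank_top, Module.finrank_prod,
    Module.finrank_self, Nat.cast_add, Nat.cast_one, one_add_one_eq_two]

lemma Tmin_eq_Tmax (τ : SturmLiouville) (h : ∀ e, ¬ τ.LimitCircle e) : τ.Tmin = τ.Tmax := by
  have hdefect {z : ℂ} (hz : z.im ≠ 0) :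
      (LinearMap.range (τ.Tmin.toFun - z • τ.Tmin.domain.subtype))ᗮ = ⊥ :=
    Submodule.rank_eq_zero.1 (τ.defectNumber_Tmin_eq_zero hz h)
  refine le_antisymm τ.Tmin_le_Tmax (LinearPMap.le_of_le_graph ?_)
  rw [Tmax_graph, ← Tmin_graph_adjoint]
  exact adjoint_graph_le_of_isFormalAdjoint τ.isFormalAdjoint_Tmin
    τ.isClosable_T0.closure_isClosed (hdefect (by simp)) (hdefect (by simp))

end SturmLiouville

theorem mainTheorem1 (τ : SturmLiouville) :
    -- the minimal operator is well defined, densely defined and symmetric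
    (Dense (τ.T0.domain : Set τ.H) ∧ τ.T0.IsClosable ∧ τ.Tmin.IsFormalAdjoint τ.Tmin) ∧
    -- Weyl's alternative at each endpoint
    (Xor τ.LimitCircleA τ.LimitPointA ∧ Xor τ.LimitCircleB τ.LimitPointB) ∧
    -- the deficiency indices of the minimal operator
    (¬ τ.LimitCircleA ∧ ¬ τ.LimitCircleB →
      defectNumber τ.Tmin Complex.I = 0 ∧ defectNumber τ.Tmin (-Complex.I) = 0) ∧
    (Xor τ.LimitCircleA τ.LimitCircleB →
      defectNumber τ.Tmin Complex.I = 1 ∧ defectNumber τ.Tmin (-Complex.I) = 1) ∧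
    (τ.LimitCircleA ∧ τ.LimitCircleB →
      defectNumber τ.Tmin Complex.I = 2 ∧ defectNumber τ.Tmin (-Complex.I) = 2) ∧
    -- the case of two limit-point endpoints
    (τ.LimitPointA ∧ τ.LimitPointB → τ.Tmin = τ.Tmax ∧ IsSelfAdjoint τ.Tmin) := by
  have hI : Complex.I.im ≠ 0 := by simp
  have hnI : (-Complex.I).im ≠ 0 := by simp
  have hneither : ¬ τ.LimitCircleA ∧ ¬ τ.LimitCircleB → ∀ e, ¬ τ.LimitCircle e :=
    (SturmLiouville.Endpoint.forall_iff (P := fun e => ¬ τ.LimitCircle e)).2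
  have hboth : τ.LimitCircleA ∧ τ.LimitCircleB → ∀ e, τ.LimitCircle e :=
    (SturmLiouville.Endpoint.forall_iff (P := τ.LimitCircle)).2
  rw [τ.limitPointA_iff_not_limitCircleA, τ.limitPointB_iff_not_limitCircleB]
  refine ⟨⟨τ.dense_T0_domain, τ.isClosable_T0, τ.isFormalAdjoint_Tmin⟩,
    ⟨xor_not_right.2 Iff.rfl, xor_not_right.2 Iff.rfl⟩,
    fun h => ⟨τ.defectNumber_Tmin_eq_zero hI (hneither h),
      τ.defectNumber_Tmin_eq_zero hnI (hneither h)⟩,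
    fun h => ⟨τ.defectNumber_Tmin_eq_one hI h, τ.defectNumber_Tmin_eq_one hnI h⟩,
    fun h => ⟨τ.defectNumber_Tmin_eq_two _ (hboth h), τ.defectNumber_Tmin_eq_two _ (hboth h)⟩,
    fun h => ?_⟩
  have heq : τ.Tmin = τ.Tmax := τ.Tmin_eq_Tmax (hneither h)
  exact ⟨heq, LinearPMap.isSelfAdjoint_def.2 (τ.Tmin_adjoint.trans heq.symm)⟩
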